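/- Let $0<r<n$ and let $U_{n,r}$ be the uniform matroid on $[n]=\{1,\dots,n\}$, whose bases are all $r$-element subsets of $[n]$. For a matroid $M$ on $[n]$ let $P_M=\mathrm{Conv}\{e_B : B \text{ a basis of } M\}\subset\mathbb{R}^n$, $e_B=\sum_{i\in B}e_i$, be its base polytope. For a composition $\alpha=(a_1,\dots,a_k)$ let $M_\alpha=\sum_{i_1<\cdots<i_k}x_{i_1}^{a_1}\cdots x_{i_k}^{a_k}$ be the monomial quasisymmetric function, and let $\circ$ be the concatenation product, the bilinear product on quasisymmetric functions with $M_\alpha\circ M_\beta=M_{\alpha\beta}$; powers $(M_1)^s$ are taken with respect to the ordinary product. A flag is a chain $\mathcal F:\emptyset=F_0\subset F_1\subset\cdots\subset F_{k+1}=[n]$ of distinct sets, of type $(|F_1|-|F_0|,\dots,|F_{k+1}|-|F_k|)$. For a matroid $M$ on $[n]$ and a flag $\mathcal F$, let $M/\mathcal F$ be the matroid whose bases are the bases of $M$ of maximum $\omega$-weight $\sum_{i\in B}\omega_i$, for any $\omega\in\mathbb{Z}_+^n$ that is constant on each block $F_{i+1}\setminus F_i$ and strictly decreases from each block to the next, and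 put $$F_q(P_M)=\sum_{\mathcal F}q^{\dim P_{M/\mathcal F}}M_{\mathrm{type}(\mathcal F)}.$$ For a generalized permutohedron $Q\subset\mathbb R^n$ let $$F^{\uparrow}_q(Q)=\sum_{\omega\in\mathbb{Z}_+^n}q^{\mathrm{rk}_Q(\mathcal F_\omega)}x_{\omega_1}\cdots x_{\omega_n},$$ where $\mathcal F_\omega$ is the flag on whose blocks $\omega$ is constant and strictly increases from each block to the next, and $\mathrm{rk}_Q(\mathcal F)$ is the dimension of the face of $Q$ on which $\langle\omega',\cdot\rangle$ is maximized for every $\omega'\in\mathbb R^n$ in the relative interior of the braid cone of $\mathcal F$ (the vectors constant on the blocks of $\mathcal F$ and strictly increasing from each block to the next). Then: 1. $P_{U_{n,r}}$ is the hypersimplex $\Delta_r^n=[0,1]^n\cap\{x_1+\cdots+x_n=r\}$. 2. $$F_q(P_{U_{n,r}})=\binom nr (M_1)^r\circ(M_1)^{n-r}+\sum_{0\le r'<r<r'+\lambda\le n}\binom n{r'}\binom{n-r'}{\lambda}q^{\lambda-1}(M_1)^{r'}\circ M_\lambda\circ(M_1)^{n-r'-\lambda},$$ and, with the opposite order of the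 factors, $$F^{\uparrow}_q(P_{U_{n,r}})=\binom nr (M_1)^{n-r}\circ(M_1)^{r}+\sum_{0\le r'<r<r'+\lambda\le n}\binom n{r'}\binom{n-r'}{\lambda}q^{\lambda-1}(M_1)^{n-r'-\lambda}\circ M_\lambda\circ(M_1)^{r'}.$$ 3. The $f$-polynomial $f(P,q)=\sum_{i=0}^{\dim P}f_iq^i$, where $f_i$ is the number of $i$-dimensional faces of $P$, satisfies $$f(\Delta_r^n,q)=f(P_{U_{n,r}},q)=\binom nr+\sum_{0\le r'<r<r'+\lambda\le n}\binom n{r'}\binom{n-r'}{\lambda}q^{\lambda-1}.$$ 4. Hence $f_0=\binom nr$ and, for $k=2,\dots,n$, $$f_{k-1}=\sum_{0\le r'<r<r'+k\le n}\binom{n}{r',\,k,\,n-r'-k}.$$ -/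

import Mathlib

open Polynomial

noncomputable section

/-! ### Quasisymmetric functions

Quasisymmetric functions are power series in `x₁, x₂, …` (variables indexed by `ℕ+`)
over `ℤ[q]`. -/

/-- The ring of power series in `x₁, x₂, …` with coefficients in `ℤ[q]`. -/
abbrev QSeries : Type := MvPowerSeries ℕ+ ℤ[X]

/-- The list of nonzero exponents of a monomial, in increasing order of the variables. -/
def exponentList (m : ℕ+ →₀ ℕ) : List ℕ :=
  (m.support.sort (· ≤ ·)).map m

open Classical in
/-- The monomial quasisymmetric function
`M_α = ∑_{i₁ < ⋯ < i_k} x_{i₁}^{a₁} ⋯ x_{i_k}^{a_k}` of a composition `α = (a₁, …, a_k)`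
(a list of positive integers). -/
def monomialQSym (α : List ℕ) : QSeries :=
  fun m => if exponentList m = α then 1 else 0

open Classical in
/-- The concatenation product: the bilinear operation which keeps, in the product of two power
series, only the products of a monomial of `F` and a monomial of `G` such that all the variables of
the first one precede all the variables of the second one. On quasisymmetric functions it is
determined by `M_α ∘ M_β = M_{αβ}`; see `concatProd_monomialQSym` and the bilinearity lemmas. -/
def concatProd (F G : QSeries) : QSeries :=
  fun m => ∑ p ∈ (Finset.HasAntidiagonal.antidiagonal m).filter
    (fun p => ∀ i ∈ p.1.support, ∀ j ∈ p.2.support, i < j), F p.1 * G p.2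

infixl:70 " ⊚ " => concatProd

open Classical in
theorem concatProd_apply (F G : QSeries) (m : ℕ+ →₀ ℕ) :
    (F ⊚ G) m = ∑ p ∈ (Finset.HasAntidiagonal.antidiagonal m).filter
      (fun p => ∀ i ∈ p.1.support, ∀ j ∈ p.2.support, i < j), F p.1 * G p.2 := rfl

theorem concatProd_add_left (F F' G : QSeries) : (F + F') ⊚ G = F ⊚ G + F' ⊚ G := by
  funext m
  have h : ∀ A B : QSeries, ∀ k, (A + B) k = A k + B k := fun _ _ _ => rfl
  simp only [h, concatProd_apply, add_mul, Finset.sum_add_distrib]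

theorem concatProd_add_right (F G G' : QSeries) : F ⊚ (G + G') = F ⊚ G + F ⊚ G' := by
  funext m
  have h : ∀ A B : QSeries, ∀ k, (A + B) k = A k + B k := fun _ _ _ => rfl
  simp only [h, concatProd_apply, mul_add, Finset.sum_add_distrib]

theorem concatProd_smul_left (c : ℤ[X]) (F G : QSeries) : (c • F) ⊚ G = c • (F ⊚ G) := by
  funext m
  have h : ∀ A : QSeries, ∀ k, (c • A) k = c * A k := fun _ _ => rfl
  simp only [h, concatProd_apply, mul_assoc, Finset.mul_sum]

theorem concatProd_smul_right (c : ℤ[X]) (F G : QSeries) : F ⊚ (c • G) = c • (F ⊚ G) := by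
  funext m
  have h : ∀ A : QSeries, ∀ k, (c • A) k = c * A k := fun _ _ => rfl
  simp only [h, concatProd_apply, mul_left_comm, Finset.mul_sum]

theorem support_sort_add {a b : ℕ+ →₀ ℕ} (h : ∀ i ∈ a.support, ∀ j ∈ b.support, i < j) :
    (a + b).support.sort (· ≤ ·) = a.support.sort (· ≤ ·) ++ b.support.sort (· ≤ ·) := by
  have hd : Disjoint a.support b.support :=
    Finset.disjoint_left.2 fun i hi hj => lt_irrefl _ (h i hi i hj)
  refine List.Perm.eq_of_pairwise (le := (· ≤ ·)) (fun x y _ _ h1 h2 => le_antisymm h1 h2)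
    (Finset.pairwise_sort _ _) ?_ ?_
  · refine List.pairwise_append.2 ⟨Finset.pairwise_sort _ _, Finset.pairwise_sort _ _, ?_⟩
    intro x hx y hy
    exact (h x ((Finset.mem_sort _).1 hx) y ((Finset.mem_sort _).1 hy)).le
  · refine (List.perm_ext_iff_of_nodup (Finset.sort_nodup _ _) ?_).2 ?_
    · refine List.nodup_append.2 ⟨Finset.sort_nodup _ _, Finset.sort_nodup _ _, ?_⟩
      intro x hx y hy hxy
      exact (h x ((Finset.mem_sort _).1 hx) y ((Finset.mem_sort _).1 hy)).ne hxy
    · intro x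
      rw [Finset.mem_sort, Finsupp.support_add_eq hd]
      simp

theorem exponentList_add {a b : ℕ+ →₀ ℕ} (h : ∀ i ∈ a.support, ∀ j ∈ b.support, i < j) :
    exponentList (a + b) = exponentList a ++ exponentList b := by
  unfold exponentList
  rw [support_sort_add h, List.map_append]
  congr 1
  · refine List.map_congr_left fun i hi => ?_
    have hi' := (Finset.mem_sort _).1 hi
    have : b i = 0 := by
      by_contra hb
      exact lt_irrefl _ (h i hi' i (Finsupp.mem_support_iff.2 hb))
    simp [this]
  · refine List.map_congr_left fun i hi => ?_
    have hi' := (Finset.mem_sort _).1 hi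
    have : a i = 0 := by
      by_contra hb
      exact lt_irrefl _ (h i (Finsupp.mem_support_iff.2 hb) i hi')
    simp [this]

theorem concatProd_monomialQSym (α β : List ℕ) :
    monomialQSym α ⊚ monomialQSym β = monomialQSym (α ++ β) := by
  classical
  funext m
  have hM : ∀ γ k, monomialQSym γ k = if exponentList k = γ then (1 : ℤ[X]) else 0 :=
    fun γ k => by unfold monomialQSym; congr
  rw [concatProd_apply, hM]
  simp only [hM]
  have hlen : ∀ a, (exponentList a).length = a.support.card := fun a => by
    simp [exponentList]
  -- The first part of an ordered splitting of `m` is determined by the size of its support.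
  have huniq : ∀ a b : ℕ+ →₀ ℕ, a + b = m → (∀ i ∈ a.support, ∀ j ∈ b.support, i < j) →
      a = m.filter (· ∈ (m.support.sort (· ≤ ·)).take a.support.card) := by
    rintro a b rfl h
    have ht : ((a + b).support.sort (· ≤ ·)).take a.support.card = a.support.sort (· ≤ ·) := by
      rw [support_sort_add h]
      simp
    rw [ht]
    ext i
    by_cases hi : i ∈ a.support
    · have : b i = 0 := by
        by_contra hb
        exact lt_irrefl _ (h i hi i (Finsupp.mem_support_iff.2 hb))
      rw [Finsupp.filter_apply_pos _ _ (by simpa using hi)]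
      simp [this]
    · rw [Finsupp.filter_apply_neg _ _ (by simpa using hi)]
      simpa using hi
  split_ifs with hm
  · set a := m.filter (· ∈ (m.support.sort (· ≤ ·)).take α.length) with ha
    set b := m.filter (fun i => ¬ i ∈ (m.support.sort (· ≤ ·)).take α.length) with hb
    have hab : a + b = m := Finsupp.filter_add_filter_not _ _
    have hs : ∀ i ∈ a.support, ∀ j ∈ b.support, i < j := by
      intro i hi j hj
      rw [ha, Finsupp.support_filter, Finset.mem_filter] at hi
      rw [hb, Finsupp.support_filter, Finset.mem_filter] at hj
      have hp : ((m.support.sort (· ≤ ·)).take α.length ++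
          (m.support.sort (· ≤ ·)).drop α.length).Pairwise (· < ·) := by
        rw [List.take_append_drop]
        exact Finset.sortedLT_sort _ |>.pairwise
      have hj2 : j ∈ (m.support.sort (· ≤ ·)).drop α.length := by
        have : j ∈ (m.support.sort (· ≤ ·)).take α.length ++
          (m.support.sort (· ≤ ·)).drop α.length := by
          rw [List.take_append_drop]
          exact (Finset.mem_sort _).2 hj.1
        exact (List.mem_append.1 this).resolve_left hj.2
      exact (List.pairwise_append.1 hp).2.2 i hi.2 j hj2
    have hcard : a.support.card = α.length := by
      have h1 : a.support = ((m.support.sort (· ≤ ·)).take α.length).toFinset := by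
        ext i
        rw [ha, Finsupp.support_filter, Finset.mem_filter, List.mem_toFinset]
        exact ⟨fun h => h.2, fun h => ⟨(Finset.mem_sort _).1 (List.mem_of_mem_take h), h⟩⟩
      rw [h1, List.toFinset_card_of_nodup ((Finset.sort_nodup _ _).sublist (List.take_sublist _ _)),
        List.length_take, min_eq_left]
      have := congrArg List.length hm
      rw [hlen, List.length_append] at this
      simp
      omega
    have hel : exponentList a = α ∧ exponentList b = β := by
      rw [← hab, exponentList_add hs] at hm
      exact List.append_inj hm (by rw [hlen, hcard])
    rw [Finset.sum_eq_single (a, b)]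
    · simp [hel]
    · rintro ⟨a', b'⟩ hp hne
      rw [Finset.mem_filter, Finset.HasAntidiagonal.mem_antidiagonal] at hp
      by_cases h1 : exponentList a' = α
      · exfalso
        have h2 := huniq a' b' hp.1 hp.2
        rw [← hlen, h1] at h2
        have h3 : a' = a := h2
        apply hne
        have h4 : a' + b' = a + b := hp.1.trans hab.symm
        rw [h3] at h4
        rw [h3, add_left_cancel h4]
      · simp [h1]
    · intro h
      exact absurd (Finset.mem_filter.2 ⟨Finset.HasAntidiagonal.mem_antidiagonal.2 hab, hs⟩) h
  · refine Finset.sum_eq_zero ?_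
    rintro ⟨a, b⟩ hp
    rw [Finset.mem_filter, Finset.HasAntidiagonal.mem_antidiagonal] at hp
    by_cases h1 : exponentList a = α
    · by_cases h2 : exponentList b = β
      · exact absurd (by rw [← hp.1, exponentList_add hp.2, h1, h2]) hm
      · simp [h2]
    · simp [h1]

/-! ### Polytopes -/

/-- The dimension of a (nonempty) convex subset of `ℝⁿ`: that of its affine hull. -/
def polytopeDim {n : ℕ} (P : Set (Fin n → ℝ)) : ℕ :=
  Module.finrank ℝ (vectorSpan ℝ P)

/-- The nonempty faces of a convex polytope, the polytope itself included: the sets where some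
linear functional attains its maximum over the polytope. -/
def faces {n : ℕ} (P : Set (Fin n → ℝ)) : Set (Set (Fin n → ℝ)) :=
  {G | G.Nonempty ∧ IsExposed ℝ P G}

/-- The number `f_i` of `i`-dimensional faces. -/
def faceNumber {n : ℕ} (P : Set (Fin n → ℝ)) (i : ℕ) : ℕ :=
  {G ∈ faces P | polytopeDim G = i}.ncard

/-- The `f`-polynomial `f_0 + f_1 q + ⋯ + f_d q^d`, where `d = dim P`. -/
def fPolynomial {n : ℕ} (P : Set (Fin n → ℝ)) : ℤ[X] :=
  ∑ i ∈ Finset.range (polytopeDim P + 1), (faceNumber P i : ℤ[X]) * X ^ i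

/-- The hypersimplex `Δ_r^n = [0,1]^n ∩ {x₁ + ⋯ + x_n = r}`. -/
def hypersimplex (n r : ℕ) : Set (Fin n → ℝ) :=
  {x | (∀ i, 0 ≤ x i ∧ x i ≤ 1) ∧ ∑ i, x i = r}

/-! ### Flags -/

/-- A flag `∅ = F_0 ⊂ F_1 ⊂ ⋯ ⊂ F_{k+1} = [n]`, given by the set of its members. -/
@[ext] structure SetFlag (n : ℕ) where
  sets : Finset (Finset (Fin n))
  empty_mem : ∅ ∈ sets
  univ_mem : Finset.univ ∈ sets
  chain : ∀ A ∈ sets, ∀ B ∈ sets, A ⊆ B ∨ B ⊆ A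

instance instFintypeSetFlag (n : ℕ) : Fintype (SetFlag n) :=
  Fintype.ofInjective SetFlag.sets fun _ _ h => SetFlag.ext h

/-- The type `(|F_1| - |F_0|, …, |F_{k+1}| - |F_k|)` of a flag: the consecutive differences
of the cardinalities of its members. -/
def SetFlag.type {n : ℕ} (F : SetFlag n) : List ℕ :=
  let c := (F.sets.image Finset.card).sort (· ≤ ·)
  List.zipWith (fun s t => t - s) c c.tail

/-- The relative interior of the braid cone of a flag: vectors that are constant on the blocks
`F_{i+1} \ F_i` and strictly increase from each block to the next one. -/
def SetFlag.braidInterior {n : ℕ} (F : SetFlag n) : Set (Fin n → ℝ) :=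
  {x | ∀ p q, x p < x q ↔ ∃ A ∈ F.sets, p ∈ A ∧ q ∉ A}

open Classical in
/-- The flag `F_ω`, whose members are `∅` and the sets `{i | ω_i ≤ ω_j}`. -/
def SetFlag.ofWeight {n : ℕ} (ω : Fin n → ℕ+) : SetFlag n where
  sets := insert ∅ (insert Finset.univ
    (Finset.univ.image fun j => Finset.univ.filter fun i => ω i ≤ ω j))
  empty_mem := by simp
  univ_mem := by simp
  chain := by
    intro A hA B hB
    simp only [Finset.mem_insert, Finset.mem_image, Finset.mem_univ, true_and] at hA hB
    rcases hA with rfl | rfl | ⟨j, rfl⟩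
    · simp
    · simp
    rcases hB with rfl | rfl | ⟨k, rfl⟩
    · simp
    · simp
    rcases le_total (ω j) (ω k) with h | h
    · left
      intro i hi
      simp only [Finset.mem_filter, Finset.mem_univ, true_and] at hi ⊢
      exact hi.trans h
    · right
      intro i hi
      simp only [Finset.mem_filter, Finset.mem_univ, true_and] at hi ⊢
      exact hi.trans h

theorem SetFlag.mem_braidInterior_ofWeight {n : ℕ} (ω : Fin n → ℕ+) :
    (fun i => ((ω i : ℕ) : ℝ)) ∈ (SetFlag.ofWeight ω).braidInterior := by
  classical
  intro p q
  simp only [Nat.cast_lt, PNat.coe_lt_coe]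
  constructor
  · intro h
    refine ⟨Finset.univ.filter fun i => ω i ≤ ω p, ?_, by simp, by simpa using h⟩
    simp only [SetFlag.ofWeight, Finset.mem_insert, Finset.mem_image, Finset.mem_univ, true_and]
    exact Or.inr (Or.inr ⟨p, rfl⟩)
  · rintro ⟨A, hA, hp, hq⟩
    simp only [SetFlag.ofWeight, Finset.mem_insert, Finset.mem_image, Finset.mem_univ,
      true_and] at hA
    rcases hA with rfl | rfl | ⟨j, rfl⟩
    · simp at hp
    · simp at hq
    · simp only [Finset.mem_filter, Finset.mem_univ, true_and, not_le] at hp hq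
      exact hp.trans_lt hq

/-! ### The weighted enumerator of a generalized permutohedron -/

/-- The face of `Q` on which the weight function `⟨ω, ·⟩` is maximized. -/
def maxFace {n : ℕ} (Q : Set (Fin n → ℝ)) (ω : Fin n → ℝ) : Set (Fin n → ℝ) :=
  {x ∈ Q | ∀ y ∈ Q, ω ⬝ᵥ y ≤ ω ⬝ᵥ x}

/-- The face `π_Q(F)` of a generalized permutohedron `Q`: the face which is the common locus of
maxima of the weight functions of all `ω` in the relative interior of the braid cone of `F`
(equivalently, the face whose normal cone contains that relative interior in its own). -/
def flagFace {n : ℕ} (Q : Set (Fin n → ℝ)) (F : SetFlag n) : Set (Fin n → ℝ) :=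
  {x | ∀ ω ∈ F.braidInterior, x ∈ maxFace Q ω}

/-- The `Q`-rank `rk_Q(F) = dim π_Q(F)`. -/
def flagRank {n : ℕ} (Q : Set (Fin n → ℝ)) (F : SetFlag n) : ℕ :=
  polytopeDim (flagFace Q F)

open Classical in
/-- `F_q(Q) = ∑_{ω ∈ ℤ_+^n} q^{rk_Q(F_ω)} x_{ω_1} ⋯ x_{ω_n}`. The coefficient of a monomial `m` is
the sum over the finitely many `ω` with `x_{ω_1} ⋯ x_{ω_n} = m`. -/
def weightEnumerator {n : ℕ} (Q : Set (Fin n → ℝ)) : QSeries :=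
  fun m => ∑ ω ∈ (Fintype.piFinset fun _ : Fin n => m.support).filter
    (fun ω => ∑ i, Finsupp.single (ω i) 1 = m), X ^ flagRank Q (SetFlag.ofWeight ω)

/-! ### Matroid base polytopes -/

/-- The convex hull of the vectors `e_B = ∑_{i ∈ B} e_i`, for `B` in a collection of subsets. -/
def basePolytope {n : ℕ} (𝓑 : Set (Set (Fin n))) : Set (Fin n → ℝ) :=
  convexHull ℝ ((fun B => B.indicator 1) '' 𝓑)

/-- The matroid base polytope `P_M`. -/
def matroidPolytope {n : ℕ} (M : Matroid (Fin n)) : Set (Fin n → ℝ) :=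
  basePolytope {B | M.IsBase B}

/-- The collection `𝓑_ω` of bases of `M` of maximum `ω`-weight. -/
def maxWeightBases {n : ℕ} (M : Matroid (Fin n)) (ω : Fin n → ℕ+) : Set (Set (Fin n)) :=
  {B | M.IsBase B ∧ ∀ B', M.IsBase B' →
    ∑ i, B'.indicator (fun i => (ω i : ℕ)) i ≤ ∑ i, B.indicator (fun i => (ω i : ℕ)) i}

/-- `ω` is constant on the blocks `F_{i+1} \ F_i` of the flag and strictly decreases from each
block to the next one. -/
def SetFlag.IsDecreasingWeight {n : ℕ} (F : SetFlag n) (ω : Fin n → ℕ+) : Prop :=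
  ∀ p q, ω q < ω p ↔ ∃ A ∈ F.sets, p ∈ A ∧ q ∉ A

/-- The bases of the matroid `M/F`, i.e. the bases of `M` of maximum `ω`-weight for all the weights
`ω` decreasing along `F` (the collection `𝓑_ω` is the same for all of these). -/
def flagBases {n : ℕ} (M : Matroid (Fin n)) (F : SetFlag n) : Set (Set (Fin n)) :=
  {B | ∀ ω, F.IsDecreasingWeight ω → B ∈ maxWeightBases M ω}

/-- The rank `dim P_{M/F}` of a flag with respect to a matroid. -/
def matroidFlagRank {n : ℕ} (M : Matroid (Fin n)) (F : SetFlag n) : ℕ :=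
  polytopeDim (basePolytope (flagBases M F))

/-- The enumerator of a matroid `M`, as a sum over all flags of subsets of the ground set:
`F_q(P_M) = ∑_F q^{dim P_{M/F}} M_{type(F)}`. -/
def matroidEnumerator {n : ℕ} (M : Matroid (Fin n)) : QSeries :=
  ∑ F : SetFlag n, (X ^ matroidFlagRank M F : ℤ[X]) • monomialQSym F.type

/-- The uniform matroid `U_{n,r}` on `[n]`, whose bases are all the `r`-element subsets. -/
def uniformMatroid (n r : ℕ) (h : r ≤ n) : Matroid (Fin n) :=
  Matroid.ofIsBaseOfFinite (E := Set.univ) Set.finite_univ (fun B => B.ncard = r)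
    (by
      obtain ⟨B, -, hB⟩ := Set.exists_subset_card_eq (s := (Set.univ : Set (Fin n)))
        (n := r) (by simpa [Set.ncard_univ] using h)
      exact ⟨B, hB⟩)
    (by
      intro B B' hB hB' e he
      have hlt : (B \ {e}).ncard < B'.ncard := by
        rw [hB', ← hB]
        exact Set.ncard_sdiff_singleton_lt_of_mem he.1
      obtain ⟨f, hf, hfn⟩ := Set.exists_mem_notMem_of_ncard_lt_ncard hlt
      have hfe : f ≠ e := fun h => he.2 (h ▸ hf)
      refine ⟨f, ⟨hf, fun hfB => hfn ⟨hfB, hfe⟩⟩, ?_⟩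
      change (insert f (B \ {e})).ncard = r
      rw [Set.ncard_insert_of_notMem hfn, Set.ncard_sdiff_singleton_add_one he.1, hB])
    (fun _ _ => Set.subset_univ _)

theorem uniformMatroid_isBase {n r : ℕ} (h : r ≤ n) (B : Set (Fin n)) :
    (uniformMatroid n r h).IsBase B ↔ B.ncard = r := Iff.rfl

end

/-! A linear functional on the hypersimplex is maximized greedily: coordinates of weight above a
threshold must be 1, those below it 0, and those on it are free as long as the total is `r`. So a
weight matters only through the pair (A, T) of elements above the threshold and on it, where either
|A| = r and T is empty, or |A| < r < |A| + |T|. Each weight has exactly one such pair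
(`exists_isCut`, `isCut_unique`), and the face it selects is `cutFace r A T`, of dimension |T| - 1,
or 0 for empty T (`isMax_iff_mem_cutFace`, `polytopeDim_cutFace`). In particular every functional
attains its maximum at some e_B, so separation identifies the hypersimplex with the base polytope.
Distinct pairs give distinct faces, and counting pairs by size (`sum_cutPairs`) yields the face
numbers.

For the enumerators, sort the weights ω by their cut (D, T): ω is arbitrary on D, constant on T,
arbitrary on the rest, with larger values on each successive block. These weights contribute M_1^|D|
∘ M_|T| ∘ M_1^(n-|D|-|T|) (`genFun_isCut`), with factor q^(|T|-1) (`rankEnumerator_eq`). The sum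
over flags becomes a sum over weights because flags whose type is the exponent list of a monomial
correspond to the weights with that monomial (`sum_flags_eq_rankEnumerator`).

A cut puts the small values of ω first. For decreasing weights D is then the forced part of the
basis and `s = r`; for increasing weights the forced part is the complement of D ∪ T and `s = n -
r`, which reverses the factors. -/

noncomputable section

/-! ### Cuts of a weight function -/

/-- `D` is an initial segment for the preorder given by `ω`, and `T` consists of elements of equal
weight which come next, before all the remaining ones. -/
def IsCut {ι L : Type*} [LinearOrder L] (ω : ι → L) (D T : Finset ι) : Prop :=
  (∀ i ∈ D, ∀ j ∉ D, ω i < ω j) ∧ (∀ i ∈ T, ∀ j ∉ D, j ∉ T → ω i < ω j) ∧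
    ∀ i ∈ T, ∀ j ∈ T, ω i = ω j

/-- The pairs of disjoint sets `(D, T)` such that either `D` has `s` elements and `T` is empty, or
`s` lies strictly between the cardinalities of `D` and of `D ∪ T`. -/
def cutPairs (n s : ℕ) : Finset (Finset (Fin n) × Finset (Fin n)) :=
  Finset.univ.filter fun p => Disjoint p.1 p.2 ∧
    (p.1.card = s ∧ p.2 = ∅ ∨ p.1.card < s ∧ s < p.1.card + p.2.card)

theorem mem_cutPairs {n s : ℕ} {p : Finset (Fin n) × Finset (Fin n)} :
    p ∈ cutPairs n s ↔ Disjoint p.1 p.2 ∧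
      (p.1.card = s ∧ p.2 = ∅ ∨ p.1.card < s ∧ s < p.1.card + p.2.card) := by
  simp [cutPairs]

theorem exists_isCut {n s : ℕ} {L : Type*} [LinearOrder L] (ω : Fin n → L) (h0 : 0 < s)
    (hs : s ≤ n) : ∃ p ∈ cutPairs n s, IsCut ω p.1 p.2 := by
  classical
  have hne : (Finset.univ : Finset (Fin n)).Nonempty := ⟨⟨0, by omega⟩, Finset.mem_univ _⟩
  -- The maximum of `ω` only shows that some `i` has at least `s` elements weakly below it; `i₀` is
  -- then the lightest such `i`, and its level is where the count reaches `s`.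
  obtain ⟨im, -, him⟩ := Finset.exists_max_image Finset.univ ω hne
  obtain ⟨i₀, hi₀, hmin⟩ := Finset.exists_min_image
    (Finset.univ.filter fun i => s ≤ (Finset.univ.filter fun j => ω j ≤ ω i).card) ω
    ⟨im, by
      have : (Finset.univ.filter fun j => ω j ≤ ω im) = Finset.univ :=
        Finset.filter_true_of_mem fun j hj => him j hj
      simp [this, hs]⟩
  simp only [Finset.mem_filter, Finset.mem_univ, true_and] at hi₀ hmin
  set D := Finset.univ.filter fun j => ω j < ω i₀ with hD
  set T := Finset.univ.filter fun j => ω j = ω i₀ with hT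
  have hdisj : Disjoint D T := by
    rw [Finset.disjoint_left]
    intro j h1 h2
    simp only [hD, hT, Finset.mem_filter, Finset.mem_univ, true_and] at h1 h2
    exact h1.ne h2
  have hDT : D ∪ T = Finset.univ.filter fun j => ω j ≤ ω i₀ := by
    ext j
    simp [hD, hT, le_iff_lt_or_eq]
  have hcard : s ≤ D.card + T.card := by
    rw [← Finset.card_union_of_disjoint hdisj, hDT]
    exact hi₀
  have hDs : D.card < s := by
    -- Otherwise the heaviest element of `D` would already have `s` elements weakly below it,
    -- against the minimality of `i₀`.
    by_contra! hge
    obtain ⟨i₁, hi₁, hmax⟩ := Finset.exists_max_image D ω (Finset.card_pos.1 (h0.trans_le hge))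
    have hlt : ω i₁ < ω i₀ := by simpa [hD] using hi₁
    refine absurd (hmin i₁ (hge.trans (Finset.card_le_card fun j hj => ?_))) (not_le.2 hlt)
    simpa using hmax j hj
  rcases hcard.eq_or_lt with h | h
  -- When the level of `i₀` is used up exactly, no choice remains and it is absorbed into the first
  -- component.
  · refine ⟨(D ∪ T, ∅), mem_cutPairs.2 ⟨by simp, Or.inl ⟨?_, rfl⟩⟩, ?_, by simp, by simp⟩
    · rw [Finset.card_union_of_disjoint hdisj, h]
    · intro i hi j hj
      simp only [hDT, Finset.mem_filter, Finset.mem_univ, true_and, not_le] at hi hj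
      exact hi.trans_lt hj
  · refine ⟨(D, T), mem_cutPairs.2 ⟨hdisj, Or.inr ⟨hDs, h⟩⟩, ?_, ?_, ?_⟩
    · intro i hi j hj
      simp only [hD, Finset.mem_filter, Finset.mem_univ, true_and, not_lt] at hi hj
      exact hi.trans_le hj
    · intro i hi j hj hj'
      simp only [hD, hT, Finset.mem_filter, Finset.mem_univ, true_and, not_lt] at hi hj hj'
      rw [hi]
      exact lt_of_le_of_ne hj (Ne.symm hj')
    · intro i hi j hj
      simp only [hT, Finset.mem_filter, Finset.mem_univ, true_and] at hi hj
      rw [hi, hj]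

/-- Initial segments form a chain: points of D \ E and E \ D would each be strictly below the other.
Hence an initial segment is determined by its size. -/
theorem subset_of_card_le_of_initial {ι L : Type*} [LinearOrder L] {ω : ι → L}
    {D E : Finset ι} (hD : ∀ i ∈ D, ∀ j ∉ D, ω i < ω j) (hE : ∀ i ∈ E, ∀ j ∉ E, ω i < ω j)
    (h : D.card ≤ E.card) : D ⊆ E := by
  intro x hx
  by_contra hxE
  have hED : E ⊆ D := fun y hy => by
    by_contra hyD
    exact lt_asymm (hD x hx y hyD) (hE y hy x hxE)
  exact hxE (Finset.eq_of_subset_of_card_le hED h ▸ hx)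

theorem IsCut.initial_union {ι L : Type*} [DecidableEq ι] [LinearOrder L] {ω : ι → L}
    {D T : Finset ι} (h : IsCut ω D T) : ∀ i ∈ D ∪ T, ∀ j ∉ D ∪ T, ω i < ω j := by
  intro i hi j hj
  rw [Finset.mem_union, not_or] at hj
  rcases Finset.mem_union.1 hi with hi | hi
  · exact h.1 i hi j hj.1
  · exact h.2.1 i hi j hj.1 hj.2

/-- No initial segment lies strictly between `D` and `D ∪ T`. -/
theorem IsCut.not_between {ι L : Type*} [DecidableEq ι] [LinearOrder L] {ω : ι → L}
    {D T E : Finset ι} (h : IsCut ω D T) (hE : ∀ i ∈ E, ∀ j ∉ E, ω i < ω j)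
    (h1 : D.card < E.card) (h2 : E.card < (D ∪ T).card) : False := by
  have hDE := subset_of_card_le_of_initial h.1 hE h1.le
  have hET := subset_of_card_le_of_initial hE h.initial_union h2.le
  obtain ⟨x, hxE, hxD⟩ := Finset.exists_mem_notMem_of_card_lt_card h1
  obtain ⟨y, hyT, hyE⟩ := Finset.exists_mem_notMem_of_card_lt_card h2
  have hxT : x ∈ T := (Finset.mem_union.1 (hET hxE)).resolve_left hxD
  have hyT : y ∈ T := (Finset.mem_union.1 hyT).resolve_left fun hy => hyE (hDE hy)
  exact (hE x hxE y hyE).ne (h.2.2 x hxT y hyT)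

/-- By the chain property it suffices to match the sizes of D and of D ∪ T; a mismatch would place
an end of one cut strictly inside the gap of the other. -/
theorem isCut_unique {n s : ℕ} {L : Type*} [LinearOrder L] {ω : Fin n → L}
    {p p' : Finset (Fin n) × Finset (Fin n)} (hp : p ∈ cutPairs n s) (hp' : p' ∈ cutPairs n s)
    (h : IsCut ω p.1 p.2) (h' : IsCut ω p'.1 p'.2) : p = p' := by
  obtain ⟨D, T⟩ := p
  obtain ⟨D', T'⟩ := p'
  obtain ⟨hd, hc⟩ := mem_cutPairs.1 hp
  obtain ⟨hd', hc'⟩ := mem_cutPairs.1 hp'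
  simp only at hd hc hd' hc' h h'
  have hu := Finset.card_union_of_disjoint hd
  have hu' := Finset.card_union_of_disjoint hd'
  have heq : ∀ {E E' : Finset (Fin n)}, (∀ i ∈ E, ∀ j ∉ E, ω i < ω j) →
      (∀ i ∈ E', ∀ j ∉ E', ω i < ω j) → E.card = E'.card → E = E' := fun hE hE' hcard =>
    Finset.Subset.antisymm (subset_of_card_le_of_initial hE hE' hcard.le)
      (subset_of_card_le_of_initial hE' hE hcard.ge)
  have n1 := fun h1 h2 => h.not_between h'.1 h1 h2
  have n2 := fun h1 h2 => h'.not_between h.1 h1 h2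
  have n3 := fun h1 h2 => h.not_between h'.initial_union h1 h2
  have n4 := fun h1 h2 => h'.not_between h.initial_union h1 h2
  have hT0 : T = ∅ → T.card = 0 := fun h => by simp [h]
  have hT0' : T' = ∅ → T'.card = 0 := fun h => by simp [h]
  have hcD : D.card = D'.card := by
    rcases hc with ⟨h1, h2⟩ | ⟨h1, h2⟩ <;> rcases hc' with ⟨h3, h4⟩ | ⟨h3, h4⟩ <;> grind
  have hcU : (D ∪ T).card = (D' ∪ T').card := by
    rcases hc with ⟨h1, h2⟩ | ⟨h1, h2⟩ <;> rcases hc' with ⟨h3, h4⟩ | ⟨h3, h4⟩ <;> grind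
  have hDD := heq h.1 h'.1 hcD
  have hUU := heq h.initial_union h'.initial_union hcU
  subst hDD
  have : T = T' := by
    rw [← Finset.union_sdiff_cancel_left hd, hUU, Finset.union_sdiff_cancel_left hd']
  rw [this]

theorem card_disjoint_pairs (n a b : ℕ) :
    ((Finset.univ : Finset (Finset (Fin n) × Finset (Fin n))).filter fun p =>
      Disjoint p.1 p.2 ∧ p.1.card = a ∧ p.2.card = b).card =
      n.choose a * (n - a).choose b := by
  classical
  have h : ((Finset.univ : Finset (Finset (Fin n) × Finset (Fin n))).filter fun p =>
      Disjoint p.1 p.2 ∧ p.1.card = a ∧ p.2.card = b).card =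
      ((Finset.powersetCard a (Finset.univ : Finset (Fin n))).sigma fun D =>
        Finset.powersetCard b Dᶜ).card := by
    refine Finset.card_bij' (fun p _ => ⟨p.1, p.2⟩) (fun p _ => (p.1, p.2)) ?_ ?_ ?_ ?_
    · rintro ⟨D, T⟩ h
      simp only [Finset.mem_filter, Finset.mem_univ, true_and] at h
      simp only [Finset.mem_sigma, Finset.mem_powersetCard, Finset.subset_univ, true_and]
      exact ⟨h.2.1, Finset.subset_compl_iff_disjoint_left.2 h.1, h.2.2⟩
    · rintro ⟨D, T⟩ h
      simp only [Finset.mem_sigma, Finset.mem_powersetCard, Finset.subset_univ, true_and] at h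
      simp only [Finset.mem_filter, Finset.mem_univ, true_and]
      exact ⟨Finset.subset_compl_iff_disjoint_left.1 h.2.1, h.1, h.2.2⟩
    · intros; rfl
    · intros; rfl
  rw [h, Finset.card_sigma, Finset.sum_const_nat (m := (n - a).choose b)]
  · simp
  · intro D hD
    rw [Finset.mem_powersetCard] at hD
    rw [Finset.card_powersetCard, Finset.card_compl, hD.2, Fintype.card_fin]

/-- The one count behind both enumerators and the face numbers. The isolated term comes from empty
T, and the sum runs over the possible sizes of D and T otherwise. -/
theorem sum_cutPairs {M : Type*} [AddCommMonoid M] (n s : ℕ) (g : ℕ → ℕ → M) :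
    ∑ p ∈ cutPairs n s, g p.1.card p.2.card =
      n.choose s • g s 0 +
      ∑ p ∈ (Finset.range (n + 1) ×ˢ Finset.range (n + 1)).filter
          (fun p => p.1 < s ∧ s < p.1 + p.2 ∧ p.1 + p.2 ≤ n),
        (n.choose p.1 * (n - p.1).choose p.2) • g p.1 p.2 := by
  classical
  have hfib : ∀ (S : Finset (Finset (Fin n) × Finset (Fin n))) (q : ℕ × ℕ),
      S = Finset.univ.filter (fun p => Disjoint p.1 p.2 ∧ p.1.card = q.1 ∧ p.2.card = q.2) →
      ∑ p ∈ S, g p.1.card p.2.card = (n.choose q.1 * (n - q.1).choose q.2) • g q.1 q.2 := by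
    rintro S q rfl
    rw [← card_disjoint_pairs, ← Finset.sum_const]
    refine Finset.sum_congr rfl fun p hp => ?_
    rw [Finset.mem_filter] at hp
    rw [hp.2.2.1, hp.2.2.2]
  rw [← Finset.sum_filter_add_sum_filter_not _ (fun p => p.2 = ∅)]
  congr 1
  · rw [hfib _ (s, 0)]
    · simp
    · ext p
      simp only [Finset.mem_filter, mem_cutPairs, Finset.mem_univ, true_and, Finset.card_eq_zero]
      constructor
      · rintro ⟨⟨h1, h2 | h2⟩, h3⟩
        · exact ⟨h1, h2⟩
        · simp [h3] at h2
          omega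
      · rintro ⟨h1, h2, h3⟩
        exact ⟨⟨h1, Or.inl ⟨h2, h3⟩⟩, h3⟩
  · rw [← Finset.sum_fiberwise_of_maps_to (g := fun p => (p.1.card, p.2.card))
      (t := (Finset.range (n + 1) ×ˢ Finset.range (n + 1)).filter
          (fun p => p.1 < s ∧ s < p.1 + p.2 ∧ p.1 + p.2 ≤ n))]
    · refine Finset.sum_congr rfl fun q hq => hfib _ q ?_
      simp only [Finset.mem_filter, Finset.mem_product, Finset.mem_range] at hq
      ext p
      simp only [Finset.mem_filter, mem_cutPairs, Finset.mem_univ, true_and, Prod.ext_iff]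
      constructor
      · rintro ⟨⟨⟨h1, h2⟩, h3⟩, h4⟩
        exact ⟨h1, h4⟩
      · rintro ⟨h1, h2, h3⟩
        refine ⟨⟨⟨h1, Or.inr (by omega)⟩, fun h => ?_⟩, h2, h3⟩
        simp [h] at h3
        omega
    · intro p hp
      simp only [Finset.mem_filter, mem_cutPairs] at hp
      obtain ⟨⟨h1, h2⟩, h3⟩ := hp
      have h4 := h2.resolve_left fun h => h3 h.2
      have h5 : (p.1 ∪ p.2).card ≤ n := by simpa using Finset.card_le_univ (p.1 ∪ p.2)
      rw [Finset.card_union_of_disjoint h1] at h5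
      simp only [Finset.mem_filter, Finset.mem_product, Finset.mem_range]
      omega

/-! ### Faces of the hypersimplex -/

/-- The face of the hypersimplex where the coordinates in `A` are `1` and those outside `A ∪ T`
are `0`. -/
def cutFace {n : ℕ} (r : ℕ) (A T : Finset (Fin n)) : Set (Fin n → ℝ) :=
  {x ∈ hypersimplex n r | (∀ i ∈ A, x i = 1) ∧ ∀ i ∉ A, i ∉ T → x i = 0}

/-- The `r`-element sets between `A` and `A ∪ T`. -/
def cutBases {n : ℕ} (r : ℕ) (A T : Finset (Fin n)) : Set (Set (Fin n)) :=
  {B | B.ncard = r ∧ ↑A ⊆ B ∧ B ⊆ ↑A ∪ ↑T}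

theorem sum_indicator_one {n : ℕ} (B : Set (Fin n)) :
    ∑ i, B.indicator (1 : Fin n → ℝ) i = B.ncard := by
  classical
  rw [Set.ncard_eq_toFinset_card', Finset.card_eq_sum_ones, Nat.cast_sum,
    ← Set.filter_mem_univ_eq_toFinset,
    Finset.sum_filter]
  exact Finset.sum_congr rfl fun i _ => by simp [Set.indicator_apply]

theorem indicator_mem_hypersimplex {n r : ℕ} {B : Set (Fin n)} (hB : B.ncard = r) :
    B.indicator 1 ∈ hypersimplex n r := by
  classical
  refine ⟨fun i => ?_, by rw [sum_indicator_one, hB]⟩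
  rw [Set.indicator_apply]
  split_ifs <;> simp

theorem indicator_mem_cutFace {n r : ℕ} {A T : Finset (Fin n)} {B : Set (Fin n)}
    (hB : B.ncard = r) : B.indicator 1 ∈ cutFace r A T ↔ B ∈ cutBases r A T := by
  classical
  constructor
  · rintro ⟨-, h1, h2⟩
    refine ⟨hB, fun i hi => ?_, fun i hi => ?_⟩
    · by_contra h
      simpa [Set.indicator_apply, h] using h1 i hi
    · by_contra h
      simp only [Set.mem_union, Finset.mem_coe, not_or] at h
      simpa [Set.indicator_apply, hi] using h2 i h.1 h.2
  · rintro ⟨-, h1, h2⟩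
    refine ⟨indicator_mem_hypersimplex hB, fun i hi => ?_, fun i hi hi' => ?_⟩
    · have : i ∈ B := h1 hi
      simp [this]
    · have : i ∉ B := fun h => by simpa [hi, hi'] using h2 h
      simp [this]

/-- `U` and `V` allow chosen elements to be forced into a basis or kept out of it. -/
theorem exists_mem_cutBases {n r : ℕ} {A T U V : Finset (Fin n)} (hAU : A ⊆ U) (hUV : U ⊆ V)
    (hV : V ⊆ A ∪ T) (h1 : U.card ≤ r) (h2 : r ≤ V.card) :
    ∃ B ∈ cutBases r A T, ↑U ⊆ B ∧ B ⊆ ↑V := by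
  obtain ⟨B, hUB, hBV, hB⟩ := Finset.exists_subsuperset_card_eq hUV h1 h2
  refine ⟨B, ⟨by simpa using hB, ?_, ?_⟩, by simpa using hUB, by simpa using hBV⟩
  · exact_mod_cast hAU.trans hUB
  · exact_mod_cast hBV.trans hV

theorem cutBases_nonempty {n r : ℕ} {p : Finset (Fin n) × Finset (Fin n)}
    (hp : p ∈ cutPairs n r) : (cutBases r p.1 p.2).Nonempty := by
  obtain ⟨hd, hc⟩ := mem_cutPairs.1 hp
  have hu := Finset.card_union_of_disjoint hd
  obtain ⟨B, hB, -⟩ := exists_mem_cutBases (r := r) (Finset.Subset.refl p.1)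
    Finset.subset_union_left (Finset.Subset.refl (p.1 ∪ p.2)) (by omega) (by omega)
  exact ⟨B, hB⟩

theorem exists_notMem_of_mem_cutPairs {n r : ℕ} {p : Finset (Fin n) × Finset (Fin n)}
    (hp : p ∈ cutPairs n r) {i : Fin n} (hi : i ∉ p.1) : ∃ B ∈ cutBases r p.1 p.2, i ∉ B := by
  obtain ⟨hd, hc⟩ := mem_cutPairs.1 hp
  have hu := Finset.card_union_of_disjoint hd
  have hsub : p.1 ⊆ (p.1 ∪ p.2).erase i := fun j hj =>
    Finset.mem_erase.2 ⟨fun h => hi (h ▸ hj), Finset.mem_union_left _ hj⟩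
  -- `h1` handles the case of empty `p.2`, where `p.1` has `r` elements; `h2` handles the other,
  -- where one element can be spared.
  have h1 := Finset.card_le_card hsub
  have h2 := Finset.pred_card_le_card_erase (a := i) (s := p.1 ∪ p.2)
  obtain ⟨B, hB, -, hBV⟩ := exists_mem_cutBases (r := r) (Finset.Subset.refl p.1) hsub
    (Finset.erase_subset _ _) (by omega) (by omega)
  exact ⟨B, hB, fun h => by simpa using hBV h⟩

theorem exists_mem_of_mem_cutPairs {n r : ℕ} {p : Finset (Fin n) × Finset (Fin n)}
    (hp : p ∈ cutPairs n r) {i : Fin n} (hi : i ∈ p.1 ∪ p.2) :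
    ∃ B ∈ cutBases r p.1 p.2, i ∈ B := by
  obtain ⟨hd, hc⟩ := mem_cutPairs.1 hp
  have hu := Finset.card_union_of_disjoint hd
  rcases hc with ⟨h1, h2⟩ | ⟨h1, h2⟩
  · obtain ⟨B, hB⟩ := cutBases_nonempty hp
    exact ⟨B, hB, hB.2.1 (by simpa [h2] using hi)⟩
  · have h3 := Finset.card_insert_le i p.1
    obtain ⟨B, hB, hUB, -⟩ := exists_mem_cutBases (r := r) (Finset.subset_insert i p.1)
      (Finset.insert_subset hi Finset.subset_union_left) (Finset.Subset.refl (p.1 ∪ p.2))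
      (by omega) (by omega)
    exact ⟨B, hB, hUB (by simp)⟩

/-! ### Maximizing a linear functional over the hypersimplex -/

/-- For empty T the threshold is a new real number inserted between the values on D and those
outside; otherwise it is the common value on T. -/
theorem exists_threshold {n : ℕ} {v : Fin n → ℝ} {D T : Finset (Fin n)} (hd : Disjoint D T)
    (h : IsCut v D T) :
    ∃ t, (∀ i ∈ D, v i < t) ∧ (∀ i ∈ T, v i = t) ∧ ∀ i ∉ D, i ∉ T → t < v i := by
  classical
  rcases T.eq_empty_or_nonempty with rfl | ⟨i₀, hi₀⟩
  · obtain ⟨t, h1, h2⟩ := Order.exists_between_finsets (D.image v) (Dᶜ.image v) (by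
      intro x hx y hy
      obtain ⟨i, hi, rfl⟩ := Finset.mem_image.1 hx
      obtain ⟨j, hj, rfl⟩ := Finset.mem_image.1 hy
      exact h.1 i hi j (by simpa using hj))
    exact ⟨t, fun i hi => h1 _ (Finset.mem_image_of_mem _ hi), by simp,
      fun i hi _ => h2 _ (Finset.mem_image_of_mem _ (by simpa using hi))⟩
  · exact ⟨v i₀, fun i hi => h.1 i hi i₀ (Finset.disjoint_right.1 hd hi₀),
      fun i hi => h.2.2 i hi i₀ hi₀, fun i hi hi' => h.2.1 i₀ hi₀ i hi hi'⟩

/-- Since the coordinates sum to `r`, subtracting `t` from every weight changes the functional by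
the constant `t * r`. The rest is maximized one coordinate at a time over [0,1], and equality in the
sum forces equality in each term. -/
theorem dotProduct_le_of_threshold {n r : ℕ} {A T : Finset (Fin n)} {w : Fin n → ℝ} {t : ℝ}
    (hA : ∀ i ∈ A, t < w i) (hT : ∀ i ∈ T, w i = t) (hC : ∀ i ∉ A, i ∉ T → w i < t)
    {x : Fin n → ℝ} (hx : x ∈ hypersimplex n r) :
    w ⬝ᵥ x ≤ ∑ i ∈ A, (w i - t) + t * r ∧
      (w ⬝ᵥ x = ∑ i ∈ A, (w i - t) + t * r ↔ x ∈ cutFace r A T) := by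
  classical
  have h1 : w ⬝ᵥ x = ∑ i, (w i - t) * x i + t * r := by
    rw [← hx.2, Finset.mul_sum, ← Finset.sum_add_distrib]
    exact Finset.sum_congr rfl fun i _ => by ring
  have h2 : ∑ i ∈ A, (w i - t) = ∑ i, if i ∈ A then w i - t else 0 := by
    simp
  have h3 : ∀ i ∈ Finset.univ, (w i - t) * x i ≤ if i ∈ A then w i - t else 0 := by
    intro i _
    obtain ⟨h0, h1⟩ := hx.1 i
    split_ifs with hi
    · have := hA i hi
      nlinarith
    · by_cases hi' : i ∈ T
      · simp [hT i hi']
      · have := hC i hi hi'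
        nlinarith
  rw [h1, h2]
  refine ⟨by linarith [Finset.sum_le_sum h3], ?_⟩
  rw [add_left_inj, Finset.sum_eq_sum_iff_of_le h3]
  constructor
  · intro h
    refine ⟨hx, fun i hi => ?_, fun i hi hi' => ?_⟩
    · have h4 := h i (Finset.mem_univ _)
      rw [if_pos hi] at h4
      have h5 := hA i hi
      exact mul_left_cancel₀ (sub_ne_zero.2 h5.ne') (by rw [h4, mul_one])
    · have h4 := h i (Finset.mem_univ _)
      rw [if_neg hi] at h4
      exact (mul_eq_zero.1 h4).resolve_left (sub_ne_zero.2 (hC i hi hi').ne)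
  · rintro ⟨-, h4, h5⟩ i -
    split_ifs with hi
    · rw [h4 i hi, mul_one]
    · by_cases hi' : i ∈ T
      · simp [hT i hi']
      · rw [h5 i hi hi', mul_zero]

/-- `S` is kept general so that this applies both to the whole hypersimplex and to the finite set of
vectors e_B. -/
theorem isMax_iff_mem_cutFace {n r : ℕ} {A T : Finset (Fin n)} {w : Fin n → ℝ} {t : ℝ}
    (hA : ∀ i ∈ A, t < w i) (hT : ∀ i ∈ T, w i = t) (hC : ∀ i ∉ A, i ∉ T → w i < t)
    {S : Set (Fin n → ℝ)} (hS : S ⊆ hypersimplex n r) (hne : (S ∩ cutFace r A T).Nonempty)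
    {x : Fin n → ℝ} (hx : x ∈ S) :
    (∀ y ∈ S, w ⬝ᵥ y ≤ w ⬝ᵥ x) ↔ x ∈ cutFace r A T := by
  obtain ⟨z, hz, hz'⟩ := hne
  have h1 := dotProduct_le_of_threshold hA hT hC (hS hx)
  have h2 := dotProduct_le_of_threshold hA hT hC (hS hz)
  constructor
  · intro h
    exact h1.2.1 (le_antisymm h1.1 (h2.2.2 hz' ▸ h z hz))
  · intro h y hy
    rw [h1.2.2 h]
    exact (dotProduct_le_of_threshold hA hT hC (hS hy)).1

theorem cutFace_inter_nonempty {n r : ℕ} {p : Finset (Fin n) × Finset (Fin n)}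
    (hp : p ∈ cutPairs n r) : (hypersimplex n r ∩ cutFace r p.1 p.2).Nonempty := by
  obtain ⟨B, hB⟩ := cutBases_nonempty hp
  exact ⟨_, indicator_mem_hypersimplex hB.1, (indicator_mem_cutFace hB.1).2 hB⟩

theorem convex_hypersimplex (n r : ℕ) : Convex ℝ (hypersimplex n r) := by
  rintro x ⟨hx, hx'⟩ y ⟨hy, hy'⟩ a b ha hb hab
  refine ⟨fun i => ?_, ?_⟩
  · have := hx i
    have := hy i
    simp only [Pi.add_apply, Pi.smul_apply, smul_eq_mul]
    constructor <;> nlinarith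
  · simp only [Pi.add_apply, Pi.smul_apply, smul_eq_mul, Finset.sum_add_distrib,
      ← Finset.mul_sum, hx', hy']
    rw [← add_mul, hab, one_mul]

theorem dual_eq_dotProduct {n : ℕ} (l : StrongDual ℝ (Fin n → ℝ)) (x : Fin n → ℝ) :
    l x = (fun i => l (Pi.single i 1)) ⬝ᵥ x := by
  conv_lhs => rw [pi_eq_sum_univ' x, map_sum]
  refine Finset.sum_congr rfl fun i _ => ?_
  rw [map_smul, smul_eq_mul, mul_comm]

theorem exists_cut_of_weight {n r : ℕ} (h0 : 0 < r) (hn : r < n) (w : Fin n → ℝ) :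
    ∃ p ∈ cutPairs n r, ∃ t : ℝ, (∀ i ∈ p.1, t < w i) ∧ (∀ i ∈ p.2, w i = t) ∧
      ∀ i ∉ p.1, i ∉ p.2 → w i < t := by
  -- The sign changes because a cut lists the smallest values first, whereas the maximum favours the
  -- largest.
  obtain ⟨p, hp, hc⟩ := exists_isCut (fun i => -w i) h0 hn.le
  obtain ⟨t, h1, h2, h3⟩ := exists_threshold (mem_cutPairs.1 hp).1 hc
  exact ⟨p, hp, -t, fun i hi => by linarith [h1 i hi], fun i hi => by linarith [h2 i hi],
    fun i hi hi' => by linarith [h3 i hi hi']⟩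

/-- A point of the hypersimplex outside the hull would be strictly separated from it by some `l`,
yet `l` attains its maximum over the hypersimplex at some e_B. -/
theorem matroidPolytope_uniformMatroid {n r : ℕ} (h0 : 0 < r) (hn : r < n) :
    matroidPolytope (uniformMatroid n r hn.le) = hypersimplex n r := by
  have hB : {B | (uniformMatroid n r hn.le).IsBase B} = {B : Set (Fin n) | B.ncard = r} :=
    Set.ext fun B => uniformMatroid_isBase hn.le B
  rw [matroidPolytope, basePolytope, hB]
  refine Set.Subset.antisymm (convexHull_min ?_ (convex_hypersimplex n r)) fun x hx => ?_
  · rintro _ ⟨B, hB, rfl⟩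
    exact indicator_mem_hypersimplex hB
  by_contra hx'
  set C := convexHull ℝ ((fun B : Set (Fin n) => B.indicator (1 : Fin n → ℝ)) '' {B | B.ncard = r})
  have hfin : ((fun B : Set (Fin n) => B.indicator (1 : Fin n → ℝ)) '' {B | B.ncard = r}).Finite :=
    (Set.toFinite _).image _
  obtain ⟨l, u, h1, h2⟩ := geometric_hahn_banach_closed_point (convex_convexHull ℝ _)
    (hfin.isClosed_convexHull ℝ) hx'
  obtain ⟨p, hp, t, hA, hT, hC⟩ := exists_cut_of_weight h0 hn fun i => l (Pi.single i 1)
  obtain ⟨B, hB⟩ := cutBases_nonempty hp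
  have h3 := h1 _ (subset_convexHull ℝ _ ⟨B, hB.1, rfl⟩)
  have h4 := (isMax_iff_mem_cutFace hA hT hC subset_rfl (cutFace_inter_nonempty hp)
    (indicator_mem_hypersimplex hB.1)).2 ((indicator_mem_cutFace hB.1).2 hB) x hx
  rw [← dual_eq_dotProduct, ← dual_eq_dotProduct] at h4
  linarith

/-! ### Dimensions of the faces -/

theorem finrank_vectorSpan_single {n : ℕ} (T : Finset (Fin n)) :
    Module.finrank ℝ (vectorSpan ℝ (Set.range fun i : T => (Pi.single (i : Fin n) 1 : Fin n → ℝ))) =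
      T.card - 1 := by
  have hli : LinearIndependent ℝ fun i : T => (Pi.single (i : Fin n) 1 : Fin n → ℝ) :=
    (Pi.linearIndependent_single_one (Fin n) ℝ).comp _ Subtype.val_injective
  rcases T.eq_empty_or_nonempty with rfl | hT
  · rw [Set.range_eq_empty, vectorSpan_empty]
    simp
  · have := hT.to_subtype
    refine hli.affineIndependent.finrank_vectorSpan ?_
    have := Finset.card_pos.2 hT
    rw [Fintype.card_coe]
    omega

/-- The directions are those of the simplex on the e_i with i in T: differences of points of the
face are supported on T and sum to zero, and conversely each e_i - e_j is the difference of two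
vertices related by a basis exchange. Only the inclusions on `S` matter, so the face and its vertex
set are treated together. -/
theorem polytopeDim_of_subset_cutFace {n r : ℕ} {p : Finset (Fin n) × Finset (Fin n)}
    (hp : p ∈ cutPairs n r) {S : Set (Fin n → ℝ)} (hS : S ⊆ cutFace r p.1 p.2)
    (hB : ∀ B ∈ cutBases r p.1 p.2, B.indicator 1 ∈ S) : polytopeDim S = p.2.card - 1 := by
  classical
  rw [← finrank_vectorSpan_single p.2, polytopeDim]
  obtain ⟨hd, hc⟩ := mem_cutPairs.1 hp
  have hu := Finset.card_union_of_disjoint hd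
  suffices h : vectorSpan ℝ S =
      vectorSpan ℝ (Set.range fun i : p.2 => (Pi.single (i : Fin n) 1 : Fin n → ℝ)) by rw [h]
  refine le_antisymm ?_ ?_
  · rw [vectorSpan, Submodule.span_le]
    rintro _ ⟨x, hx, y, hy, rfl⟩
    obtain ⟨⟨-, hx1⟩, hx2, hx3⟩ := hS hx
    obtain ⟨⟨-, hy1⟩, hy2, hy3⟩ := hS hy
    have hz : ∀ i ∉ p.2, (x - y) i = 0 := by
      intro i hi
      by_cases hi' : i ∈ p.1
      · simp [hx2 i hi', hy2 i hi']
      · simp [hx3 i hi' hi, hy3 i hi' hi]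
    have hsum : ∑ i ∈ p.2, (x - y) i = 0 := by
      rw [Finset.sum_subset (Finset.subset_univ _) fun i _ hi => hz i hi]
      simp [hx1, hy1]
    have hxy : x - y = ∑ i ∈ p.2, (x - y) i • (Pi.single i 1 : Fin n → ℝ) := by
      ext j
      simp only [Finset.sum_apply, Pi.smul_apply, Pi.single_apply, smul_eq_mul, mul_ite, mul_one,
        mul_zero, Finset.sum_ite_eq]
      split_ifs with hj
      · rfl
      · exact hz j hj
    change x - y ∈ vectorSpan ℝ _
    rcases p.2.eq_empty_or_nonempty with hT | ⟨i₀, hi₀⟩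
    · rw [hxy, hT]
      simp
    -- As the coefficients sum to zero, subtracting e_{i₀} from every basis vector changes nothing.
    · have : x - y = ∑ i ∈ p.2, (x - y) i • ((Pi.single i 1 : Fin n → ℝ) - Pi.single i₀ 1) := by
        simp only [smul_sub, Finset.sum_sub_distrib, ← Finset.sum_smul, hsum, zero_smul, sub_zero]
        exact hxy
      rw [this]
      refine Submodule.sum_mem _ fun i hi => Submodule.smul_mem _ _ ?_
      exact vsub_mem_vectorSpan ℝ ⟨⟨i, hi⟩, rfl⟩ ⟨⟨i₀, hi₀⟩, rfl⟩
  · rw [vectorSpan, Submodule.span_le]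
    rintro _ ⟨_, ⟨⟨i, hi⟩, rfl⟩, _, ⟨⟨j, hj⟩, rfl⟩, rfl⟩
    simp only [vsub_eq_sub]
    by_cases hij : i = j
    · simp [hij]
    rcases hc with ⟨-, hT⟩ | ⟨h1, h2⟩
    · simp [hT] at hi
    have hiA : i ∉ p.1 := Finset.disjoint_right.1 hd hi
    have hjA : j ∉ p.1 := Finset.disjoint_right.1 hd hj
    have hju : j ∈ p.1 ∪ p.2 := Finset.mem_union_right _ hj
    have hc1 := Finset.card_insert_of_notMem hiA
    have hc2 := Finset.card_erase_of_mem hju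
    -- The strict inequalities |A| < r < |A| + |T| leave room to include `i` and to omit `j`.
    obtain ⟨B, hBm, hUB, hBV⟩ := exists_mem_cutBases (r := r) (Finset.subset_insert i p.1)
      (V := (p.1 ∪ p.2).erase j) (Finset.insert_subset (by simp [hij, hi]) fun k hk =>
        Finset.mem_erase.2 ⟨fun h => hjA (h ▸ hk), Finset.mem_union_left _ hk⟩)
      (Finset.erase_subset _ _) (by omega) (by omega)
    have hiB : i ∈ B := hUB (by simp)
    have hjB : j ∉ B := fun h => by simpa using hBV h
    have hB' : insert j (B \ {i}) ∈ cutBases r p.1 p.2 := by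
      refine ⟨?_, fun k hk => Or.inr ⟨hBm.2.1 hk, fun h => hiA (h ▸ hk)⟩, ?_⟩
      · rw [Set.ncard_insert_of_notMem (fun h => hjB h.1), Set.ncard_sdiff_singleton_add_one hiB,
          hBm.1]
      · rintro k (rfl | hk)
        · exact Or.inr hj
        · exact hBm.2.2 hk.1
    have heq : (Pi.single i 1 : Fin n → ℝ) - Pi.single j 1 =
        (B.indicator 1 : Fin n → ℝ) - (insert j (B \ {i})).indicator 1 := by
      ext k
      by_cases hki : k = i
      · subst hki
        simp [hiB, hij]
      · by_cases hkj : k = j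
        · subst hkj
          simp [hjB, hki]
        · simp [Set.indicator_apply, hki, hkj]
    rw [heq]
    exact vsub_mem_vectorSpan ℝ (hB _ hBm) (hB _ hB')

theorem polytopeDim_cutFace {n r : ℕ} {p : Finset (Fin n) × Finset (Fin n)}
    (hp : p ∈ cutPairs n r) : polytopeDim (cutFace r p.1 p.2) = p.2.card - 1 :=
  polytopeDim_of_subset_cutFace hp subset_rfl fun _ hB => (indicator_mem_cutFace hB.1).2 hB

theorem polytopeDim_basePolytope_cutBases {n r : ℕ} {p : Finset (Fin n) × Finset (Fin n)}
    (hp : p ∈ cutPairs n r) : polytopeDim (basePolytope (cutBases r p.1 p.2)) = p.2.card - 1 := by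
  rw [basePolytope, polytopeDim, ← direction_affineSpan, affineSpan_convexHull,
    direction_affineSpan, ← polytopeDim]
  refine polytopeDim_of_subset_cutFace hp ?_ fun B hB => ⟨B, hB, rfl⟩
  rintro _ ⟨B, hB, rfl⟩
  exact (indicator_mem_cutFace hB.1).2 hB

theorem polytopeDim_hypersimplex {n r : ℕ} (h0 : 0 < r) (hn : r < n) :
    polytopeDim (hypersimplex n r) = n - 1 := by
  have hp : ((∅ : Finset (Fin n)), (Finset.univ : Finset (Fin n))) ∈ cutPairs n r :=
    mem_cutPairs.2 ⟨by simp, Or.inr (by simp [h0, hn])⟩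
  have h : hypersimplex n r = cutFace r (∅ : Finset (Fin n)) Finset.univ := by
    simp [cutFace]
  rw [h, polytopeDim_cutFace hp]
  simp

/-! ### Classification and enumeration of the faces -/

theorem faces_hypersimplex {n r : ℕ} (h0 : 0 < r) (hn : r < n) :
    faces (hypersimplex n r) = (fun p : Finset (Fin n) × Finset (Fin n) => cutFace r p.1 p.2) ''
      (cutPairs n r : Set (Finset (Fin n) × Finset (Fin n))) := by
  classical
  ext G
  constructor
  · rintro ⟨hne, hG⟩
    obtain ⟨l, rfl⟩ := hG hne
    obtain ⟨p, hp, t, hA, hT, hC⟩ := exists_cut_of_weight h0 hn fun i => l (Pi.single i 1)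
    refine ⟨p, hp, ?_⟩
    ext x
    have hx : x ∈ {x ∈ hypersimplex n r | ∀ y ∈ hypersimplex n r, l y ≤ l x} ↔
        x ∈ hypersimplex n r ∧ ∀ y ∈ hypersimplex n r,
          (fun i => l (Pi.single i 1)) ⬝ᵥ y ≤ (fun i => l (Pi.single i 1)) ⬝ᵥ x := by
      simp only [← dual_eq_dotProduct]
      rfl
    rw [hx]
    constructor
    · intro hx
      exact ⟨hx.1, (isMax_iff_mem_cutFace hA hT hC subset_rfl (cutFace_inter_nonempty hp) hx.1).2
        hx⟩
    · rintro ⟨hx, hx'⟩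
      exact (isMax_iff_mem_cutFace hA hT hC subset_rfl (cutFace_inter_nonempty hp) hx).1 hx'
  · rintro ⟨p, hp, rfl⟩
    have hp' : p ∈ cutPairs n r := hp
    refine ⟨(cutFace_inter_nonempty hp').mono Set.inter_subset_right, fun _ => ?_⟩
    -- Weights 2, 1, 0 with threshold 1 expose exactly the face of `p`.
    set w : Fin n → ℝ := fun i => if i ∈ p.1 then 2 else if i ∈ p.2 then 1 else 0 with hw
    have hd := (mem_cutPairs.1 hp').1
    have hA : ∀ i ∈ p.1, 1 < w i := fun i hi => by simp [hw, hi]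
    have hT : ∀ i ∈ p.2, w i = 1 := fun i hi => by
      simp [hw, hi, Finset.disjoint_right.1 hd hi]
    have hC : ∀ i ∉ p.1, i ∉ p.2 → w i < 1 := fun i hi hi' => by simp [hw, hi, hi']
    have hl : ∀ x, (∑ i, w i • ContinuousLinearMap.proj i : StrongDual ℝ (Fin n → ℝ)) x = w ⬝ᵥ x :=
      fun x => by simp [dotProduct]
    refine ⟨∑ i, w i • ContinuousLinearMap.proj i, ?_⟩
    simp only [hl]
    ext x
    constructor
    · intro hx
      exact ⟨hx.1, (isMax_iff_mem_cutFace hA hT hC subset_rfl (cutFace_inter_nonempty hp') hx.1).2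
        hx⟩
    · rintro ⟨hx, hx'⟩
      exact (isMax_iff_mem_cutFace hA hT hC subset_rfl (cutFace_inter_nonempty hp') hx).1 hx'

/-- The face determines A as the set of coordinates identically 1 on it, and A ∪ T as the set of
coordinates not identically 0. -/
theorem cutFace_injOn (n r : ℕ) :
    Set.InjOn (fun p : Finset (Fin n) × Finset (Fin n) => cutFace r p.1 p.2)
      (cutPairs n r : Set _) := by
  have hA : ∀ p ∈ cutPairs n r, ∀ i, i ∈ p.1 ↔ ∀ x ∈ cutFace r p.1 p.2, x i = 1 := by
    intro p hp i
    refine ⟨fun hi x hx => hx.2.1 i hi, fun h => ?_⟩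
    by_contra hi
    obtain ⟨B, hB, hiB⟩ := exists_notMem_of_mem_cutPairs hp hi
    simpa [hiB] using h _ ((indicator_mem_cutFace hB.1).2 hB)
  have hU : ∀ p ∈ cutPairs n r, ∀ i, i ∈ p.1 ∪ p.2 ↔ ∃ x ∈ cutFace r p.1 p.2, x i ≠ 0 := by
    intro p hp i
    constructor
    · intro hi
      obtain ⟨B, hB, hiB⟩ := exists_mem_of_mem_cutPairs hp hi
      exact ⟨_, (indicator_mem_cutFace hB.1).2 hB, by simp [hiB]⟩
    · rintro ⟨x, hx, hxi⟩
      by_contra hi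
      rw [Finset.mem_union, not_or] at hi
      exact hxi (hx.2.2 i hi.1 hi.2)
  rintro p hp q hq h
  simp only at h
  have h1 : p.1 = q.1 := by
    ext i
    rw [hA p hp, hA q hq, h]
  have h2 : p.1 ∪ p.2 = q.1 ∪ q.2 := by
    ext i
    rw [hU p hp, hU q hq, h]
  refine Prod.ext h1 ?_
  rw [← Finset.union_sdiff_cancel_left (mem_cutPairs.1 hp).1, h2, h1,
    Finset.union_sdiff_cancel_left (mem_cutPairs.1 hq).1]

theorem faceNumber_hypersimplex {n r : ℕ} (h0 : 0 < r) (hn : r < n) (i : ℕ) :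
    faceNumber (hypersimplex n r) i = ((cutPairs n r).filter fun p => p.2.card - 1 = i).card := by
  have h : {G ∈ faces (hypersimplex n r) | polytopeDim G = i} =
      (fun p : Finset (Fin n) × Finset (Fin n) => cutFace r p.1 p.2) ''
        ((cutPairs n r).filter fun p => p.2.card - 1 = i : Finset _) := by
    rw [faces_hypersimplex h0 hn]
    ext G
    constructor
    · rintro ⟨⟨p, hp, rfl⟩, hG⟩
      exact ⟨p, by simpa using ⟨hp, (polytopeDim_cutFace hp).symm.trans hG⟩, rfl⟩
    · rintro ⟨p, hp, rfl⟩
      rw [Finset.mem_coe, Finset.mem_filter] at hp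
      exact ⟨⟨p, hp.1, rfl⟩, (polytopeDim_cutFace hp.1).trans hp.2⟩
  rw [faceNumber, h, Set.InjOn.ncard_image, Set.ncard_coe_finset]
  exact (cutFace_injOn n r).mono fun p hp => (Finset.mem_filter.1 hp).1

theorem faceNumber_hypersimplex_eq_sum {n r : ℕ} (h0 : 0 < r) (hn : r < n) (i : ℕ) :
    faceNumber (hypersimplex n r) i = n.choose r * (if i = 0 then 1 else 0) +
      ∑ p ∈ (Finset.range (n + 1) ×ˢ Finset.range (n + 1)).filter
          (fun p => p.1 < r ∧ r < p.1 + p.2 ∧ p.1 + p.2 ≤ n),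
        (n.choose p.1 * (n - p.1).choose p.2) * (if p.2 - 1 = i then 1 else 0) := by
  rw [faceNumber_hypersimplex h0 hn, Finset.card_filter,
    sum_cutPairs n r fun _ b => if b - 1 = i then 1 else 0]
  simp [eq_comm]

theorem faceNumber_hypersimplex_zero {n r : ℕ} (h0 : 0 < r) (hn : r < n) :
    faceNumber (hypersimplex n r) 0 = n.choose r := by
  rw [faceNumber_hypersimplex_eq_sum h0 hn, Finset.sum_eq_zero]
  · simp
  · intro p hp
    rw [Finset.mem_filter] at hp
    -- Here `p.2` is at least 2, so only the pairs with empty T are vertices.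
    rw [if_neg (by omega), mul_zero]

theorem choose_mul_choose_eq_multinomial {n a b : ℕ} (h : a + b ≤ n) :
    n.choose a * (n - a).choose b = Nat.multinomial Finset.univ ![a, b, n - a - b] := by
  have h1 := Nat.choose_mul_factorial_mul_factorial (show a ≤ n by omega)
  have h2 := Nat.choose_mul_factorial_mul_factorial (show b ≤ n - a by omega)
  have h3 := Nat.multinomial_spec Finset.univ ![a, b, n - a - b]
  simp only [Fin.prod_univ_three, Fin.sum_univ_three, Matrix.cons_val_zero, Matrix.cons_val_one,
    Matrix.cons_val] at h3
  rw [show a + b + (n - a - b) = n by omega] at h3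
  have h4 : 0 < a.factorial * b.factorial * (n - a - b).factorial := by positivity
  refine Nat.eq_of_mul_eq_mul_left h4 (Eq.trans ?_ h3.symm)
  rw [← h1, ← h2]
  ring

theorem faceNumber_hypersimplex_sub_one {n r : ℕ} (h0 : 0 < r) (hn : r < n) {k : ℕ} (hk : 2 ≤ k)
    (hkn : k ≤ n) : faceNumber (hypersimplex n r) (k - 1) =
      ∑ s ∈ (Finset.range (n + 1)).filter (fun s => s < r ∧ r < s + k ∧ s + k ≤ n),
        Nat.multinomial Finset.univ ![s, k, n - s - k] := by
  rw [faceNumber_hypersimplex_eq_sum h0 hn, if_neg (by omega), mul_zero, zero_add]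
  simp only [mul_ite, mul_one, mul_zero]
  rw [← Finset.sum_filter]
  symm
  refine Finset.sum_bij' (fun s _ => (s, k)) (fun p _ => p.1) ?_ ?_ ?_ ?_ ?_
  · intro s hs
    simp only [Finset.mem_filter, Finset.mem_range, Finset.mem_product] at hs ⊢
    exact ⟨⟨⟨hs.1, by omega⟩, hs.2⟩, trivial⟩
  · rintro ⟨s, l⟩ hp
    simp only [Finset.mem_filter, Finset.mem_range, Finset.mem_product] at hp ⊢
    obtain ⟨⟨h1, h2, h3, h4⟩, h5⟩ := hp
    -- `l ≥ 2` makes the truncated subtraction in `l - 1 = k - 1` harmless.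
    obtain rfl : l = k := by omega
    exact ⟨h1.1, h2, h3, h4⟩
  · intros; rfl
  · rintro ⟨s, l⟩ hp
    simp only [Finset.mem_filter, Finset.mem_range, Finset.mem_product] at hp
    simp only [Prod.mk.injEq, true_and]
    omega
  · intro s hs
    rw [Finset.mem_filter] at hs
    exact (choose_mul_choose_eq_multinomial hs.2.2.2).symm

theorem fPolynomial_hypersimplex {n r : ℕ} (h0 : 0 < r) (hn : r < n) :
    fPolynomial (hypersimplex n r) = (n.choose r : ℤ[X]) +
      ∑ p ∈ (Finset.range (n + 1) ×ˢ Finset.range (n + 1)).filter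
          (fun p => p.1 < r ∧ r < p.1 + p.2 ∧ p.1 + p.2 ≤ n),
        (n.choose p.1 : ℤ[X]) * ((n - p.1).choose p.2 : ℤ[X]) * X ^ (p.2 - 1) := by
  -- For empty T the exponent 0 - 1 truncates to 0, the dimension of a vertex.
  have h := sum_cutPairs n r fun _ b => (X ^ (b - 1) : ℤ[X])
  simp only [nsmul_eq_mul, Nat.cast_mul, zero_tsub, pow_zero, mul_one] at h
  rw [← h, fPolynomial, polytopeDim_hypersimplex h0 hn,
    ← Finset.sum_fiberwise_of_maps_to (g := fun p : Finset (Fin n) × Finset (Fin n) => p.2.card - 1)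
       (t := Finset.range (n - 1 + 1))]
  · refine Finset.sum_congr rfl fun i _ => ?_
    rw [faceNumber_hypersimplex h0 hn, ← nsmul_eq_mul, ← Finset.sum_const]
    refine Finset.sum_congr rfl fun p hp => ?_
    rw [(Finset.mem_filter.1 hp).2]
  · intro p _
    have : p.2.card ≤ n := by simpa using Finset.card_le_univ p.2
    rw [Finset.mem_range]
    omega

/-! ### Generating functions of families of weights -/

/-- The exponent of the monomial `∏ i, x_{ω i}`. -/
def weightContent {ι : Type*} [Fintype ι] (ω : ι → ℕ+) : ℕ+ →₀ ℕ :=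
  ∑ i, Finsupp.single (ω i) 1

theorem weightContent_apply {ι : Type*} [Fintype ι] (ω : ι → ℕ+) (v : ℕ+) :
    weightContent ω v = (Finset.univ.filter fun i => ω i = v).card := by
  simp [weightContent, Finsupp.finsetSum_apply, Finsupp.single_apply]

theorem mem_support_weightContent {ι : Type*} [Fintype ι] (ω : ι → ℕ+) (v : ℕ+) :
    v ∈ (weightContent ω).support ↔ ∃ i, ω i = v := by
  rw [Finsupp.mem_support_iff, weightContent_apply, Finset.card_ne_zero]
  simp [Finset.Nonempty]

theorem weightContent_sum {ι κ : Type*} [Fintype ι] [Fintype κ] (ω : ι ⊕ κ → ℕ+) :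
    weightContent ω = weightContent (ω ∘ Sum.inl) + weightContent (ω ∘ Sum.inr) := by
  simp [weightContent, Fintype.sum_sum_type]

theorem weightContent_comp_equiv {ι κ : Type*} [Fintype ι] [Fintype κ] (e : ι ≃ κ) (ω : κ → ℕ+) :
    weightContent (ω ∘ e) = weightContent ω :=
  e.sum_comp fun i => Finsupp.single (ω i) 1

/-- The weights of a given content. -/
def weightsOfContent (ι : Type*) [Fintype ι] [DecidableEq ι] (m : ℕ+ →₀ ℕ) : Finset (ι → ℕ+) :=
  open Classical in (Fintype.piFinset fun _ : ι => m.support).filter fun ω => weightContent ω = m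

theorem mem_weightsOfContent {ι : Type*} [Fintype ι] [DecidableEq ι] {m : ℕ+ →₀ ℕ} {ω : ι → ℕ+} :
    ω ∈ weightsOfContent ι m ↔ weightContent ω = m := by
  simp only [weightsOfContent, Finset.mem_filter, Fintype.mem_piFinset, and_iff_right_iff_imp]
  rintro rfl i
  exact (mem_support_weightContent ω _).2 ⟨i, rfl⟩

/-- Finiteness makes the `Nat.card` in `genFun` a genuine count. -/
instance finite_weights {ι : Type*} [Fintype ι] (P : (ι → ℕ+) → Prop) (m : ℕ+ →₀ ℕ) :
    Finite {ω : ι → ℕ+ // P ω ∧ weightContent ω = m} := by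
  classical
  exact ((weightsOfContent ι m).finite_toSet.subset fun ω (h : P ω ∧ weightContent ω = m) =>
    mem_weightsOfContent.2 h.2).to_subtype

/-- The sum of the monomials `∏ i, x_{ω i}` over all weights `ω` with the property `P`. -/
def genFun {ι : Type*} [Fintype ι] (P : (ι → ℕ+) → Prop) : QSeries :=
  fun m => (Nat.card {ω : ι → ℕ+ // P ω ∧ weightContent ω = m} : ℤ[X])

theorem genFun_apply {ι : Type*} [Fintype ι] (P : (ι → ℕ+) → Prop) (m : ℕ+ →₀ ℕ) :
    genFun P m = (Nat.card {ω : ι → ℕ+ // P ω ∧ weightContent ω = m} : ℤ[X]) := rfl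

theorem genFun_comp_equiv {ι κ : Type*} [Fintype ι] [Fintype κ] (e : ι ≃ κ)
    (P : (ι → ℕ+) → Prop) : genFun P = genFun fun ω : κ → ℕ+ => P (ω ∘ e) := by
  funext m
  rw [genFun_apply, genFun_apply]
  congr 1
  refine Nat.card_congr ((e.arrowCongr (Equiv.refl ℕ+)).subtypeEquiv fun ω => ?_)
  have h : (e.arrowCongr (Equiv.refl ℕ+) ω) ∘ e = ω := by
    ext i
    simp
  rw [h, ← weightContent_comp_equiv e, h]

/-- The convolution of two generating functions along a set of pairs of monomials. -/
theorem sum_antidiagonal_genFun {ι κ : Type*} [Fintype ι] [Fintype κ] (P : (ι → ℕ+) → Prop)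
    (Q : (κ → ℕ+) → Prop) (S : (ℕ+ →₀ ℕ) × (ℕ+ →₀ ℕ) → Prop) [DecidablePred S] (m : ℕ+ →₀ ℕ) :
    ∑ p ∈ (Finset.HasAntidiagonal.antidiagonal m).filter S, genFun P p.1 * genFun Q p.2 =
      genFun (fun ω : ι ⊕ κ → ℕ+ => P (ω ∘ Sum.inl) ∧ Q (ω ∘ Sum.inr) ∧
        S (weightContent (ω ∘ Sum.inl), weightContent (ω ∘ Sum.inr))) m := by
  -- A weight on a disjoint union is a pair of weights, here grouped by the pair of their contents.
  let e : {ω : ι ⊕ κ → ℕ+ // (P (ω ∘ Sum.inl) ∧ Q (ω ∘ Sum.inr) ∧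
        S (weightContent (ω ∘ Sum.inl), weightContent (ω ∘ Sum.inr))) ∧ weightContent ω = m} ≃
      Σ p : ((Finset.HasAntidiagonal.antidiagonal m).filter S : Finset _),
        {a : ι → ℕ+ // P a ∧ weightContent a = p.1.1} × {b : κ → ℕ+ // Q b ∧ weightContent b = p.1.2} :=
    { toFun := fun ω => ⟨⟨(weightContent (ω.1 ∘ Sum.inl), weightContent (ω.1 ∘ Sum.inr)), by
          rw [Finset.mem_filter, Finset.HasAntidiagonal.mem_antidiagonal, ← weightContent_sum]
          exact ⟨ω.2.2, ω.2.1.2.2⟩⟩,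
        ⟨ω.1 ∘ Sum.inl, ω.2.1.1, rfl⟩, ⟨ω.1 ∘ Sum.inr, ω.2.1.2.1, rfl⟩⟩
      invFun := fun x => ⟨Sum.elim x.2.1.1 x.2.2.1, by
        obtain ⟨⟨⟨p, q⟩, hp⟩, ⟨a, ha, ha'⟩, ⟨b, hb, hb'⟩⟩ := x
        simp only at ha' hb'
        subst ha' hb'
        rw [Finset.mem_filter, Finset.HasAntidiagonal.mem_antidiagonal] at hp
        rw [weightContent_sum]
        exact ⟨⟨ha, hb, hp.2⟩, hp.1⟩⟩
      left_inv := fun ω => Subtype.ext (Sum.elim_comp_inl_inr ω.1)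
      right_inv := by
        rintro ⟨⟨⟨p, q⟩, hp⟩, ⟨a, ha, ha'⟩, ⟨b, hb, hb'⟩⟩
        simp only at ha' hb'
        subst ha' hb'
        rfl }
  rw [genFun_apply, Nat.card_congr e, Nat.card_sigma, Nat.cast_sum,
    ← Finset.sum_coe_sort ((Finset.HasAntidiagonal.antidiagonal m).filter S)]
  refine Finset.sum_congr rfl fun p _ => ?_
  rw [Nat.card_prod, Nat.cast_mul]
  rfl

theorem genFun_mul_genFun {ι κ : Type*} [Fintype ι] [Fintype κ] (P : (ι → ℕ+) → Prop)
    (Q : (κ → ℕ+) → Prop) :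
    genFun P * genFun Q =
      genFun fun ω : ι ⊕ κ → ℕ+ => P (ω ∘ Sum.inl) ∧ Q (ω ∘ Sum.inr) := by
  classical
  funext m
  have h := sum_antidiagonal_genFun P Q (fun _ => True) m
  simp only [Finset.filter_true, and_true] at h
  rw [← h]
  exact MvPowerSeries.coeff_mul m (genFun P) (genFun Q)

theorem concatProd_genFun {ι κ : Type*} [Fintype ι] [Fintype κ] (P : (ι → ℕ+) → Prop)
    (Q : (κ → ℕ+) → Prop) :
    genFun P ⊚ genFun Q = genFun fun ω : ι ⊕ κ → ℕ+ =>
      P (ω ∘ Sum.inl) ∧ Q (ω ∘ Sum.inr) ∧ ∀ i j, ω (Sum.inl i) < ω (Sum.inr j) := by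
  classical
  funext m
  rw [concatProd_apply, sum_antidiagonal_genFun P Q]
  congr 2
  funext ω
  simp only [mem_support_weightContent, Function.comp_apply, forall_exists_index,
    forall_apply_eq_imp_iff]

theorem exponentList_single (t : ℕ+) {b : ℕ} (hb : b ≠ 0) :
    exponentList (Finsupp.single t b) = [b] := by
  simp [exponentList, Finsupp.support_single, hb]

theorem exponentList_eq_nil {m : ℕ+ →₀ ℕ} : exponentList m = [] ↔ m = 0 := by
  rw [← List.length_eq_zero_iff]
  simp [exponentList]

theorem exponentList_eq_singleton {m : ℕ+ →₀ ℕ} {b : ℕ} (hb : b ≠ 0) :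
    exponentList m = [b] ↔ ∃ t, m = Finsupp.single t b := by
  constructor
  · intro h
    have h1 : m.support.card = 1 := by
      have := congrArg List.length h
      simpa [exponentList] using this
    obtain ⟨t, -, ht⟩ := Finsupp.card_support_eq_one.1 h1
    refine ⟨t, ?_⟩
    have h2 : m t ≠ 0 := fun h0 => by
      rw [ht, h0] at h1
      simp at h1
    rw [ht, exponentList_single t h2] at h
    rw [ht]
    congr 1
    simpa using h
  · rintro ⟨t, rfl⟩
    exact exponentList_single t hb

/-- An empty index set carries one weight, the empty one, contributing M_∅ = 1. The list must then
be `[]`, since `[0]` is never an exponent list. -/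
theorem genFun_const {ι : Type*} [Fintype ι] :
    genFun (fun ω : ι → ℕ+ => ∀ i j, ω i = ω j) =
      monomialQSym (if Fintype.card ι = 0 then [] else [Fintype.card ι]) := by
  classical
  funext m
  have hc : ∀ t : ℕ+, weightContent (fun _ : ι => t) = Finsupp.single t (Fintype.card ι) := fun t => by
    simp [weightContent]
  rw [genFun_apply, monomialQSym]
  split_ifs with h0 hm hm
  · rw [exponentList_eq_nil] at hm
    have := Fintype.card_eq_zero_iff.1 h0
    subst hm
    rw [Nat.card_eq_one_iff_unique.2]
    · simp
    · refine ⟨⟨fun a b => Subtype.ext (Subsingleton.elim _ _)⟩, ⟨⟨isEmptyElim, by simp, by simp [weightContent]⟩⟩⟩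
  · rw [exponentList_eq_nil] at hm
    have := Fintype.card_eq_zero_iff.1 h0
    have : IsEmpty {ω : ι → ℕ+ // (∀ i j, ω i = ω j) ∧ weightContent ω = m} :=
      ⟨fun a => hm (a.2.2.symm.trans (by simp [weightContent]))⟩
    rw [Nat.card_of_isEmpty, Nat.cast_zero]
  · obtain ⟨t, rfl⟩ := (exponentList_eq_singleton h0).1 hm
    have hne := Fintype.card_pos_iff.1 (Nat.pos_of_ne_zero h0)
    rw [Nat.card_eq_one_iff_unique.2]
    · simp
    · refine ⟨⟨?_⟩, ⟨⟨fun _ => t, fun _ _ => rfl, hc t⟩⟩⟩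
      have key : ∀ ω : ι → ℕ+, weightContent ω = Finsupp.single t (Fintype.card ι) → ω = fun _ => t := by
        intro ω h
        funext i
        have := (mem_support_weightContent ω (ω i)).2 ⟨i, rfl⟩
        rw [h] at this
        simpa [Finsupp.support_single, h0] using this
      rintro ⟨a, ha, ha'⟩ ⟨b, hb, hb'⟩
      exact Subtype.ext ((key a ha').trans (key b hb').symm)
  · have hne := Fintype.card_pos_iff.1 (Nat.pos_of_ne_zero h0)
    obtain ⟨i₀⟩ := hne
    have : IsEmpty {ω : ι → ℕ+ // (∀ i j, ω i = ω j) ∧ weightContent ω = m} := by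
      refine ⟨fun a => hm ((exponentList_eq_singleton h0).2 ⟨a.1 i₀, ?_⟩)⟩
      rw [← hc]
      refine a.2.2.symm.trans (congrArg weightContent ?_)
      funext i
      exact a.2.1 i i₀
    simp

theorem monomialQSym_one_pow (s : ℕ) :
    monomialQSym [1] ^ s = genFun fun _ : Fin s → ℕ+ => True := by
  -- On at most one index every weight is constant, so `genFun_const` supplies both the unit and
  -- M_1.
  have h1 : ∀ k, k < 2 → genFun (fun _ : Fin k → ℕ+ => True) =
      monomialQSym (if k = 0 then [] else [k]) := by
    intro k hk
    have h := genFun_const (ι := Fin k)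
    rw [Fintype.card_fin] at h
    rw [← h]
    congr 1
    funext ω
    refine (eq_true fun i j => ?_).symm
    rw [show i = j from Fin.ext (by omega)]
  induction s with
  | zero =>
    rw [h1 0 (by omega), pow_zero]
    funext m
    rw [if_pos rfl, monomialQSym]
    simp only [exponentList_eq_nil]
    exact MvPowerSeries.coeff_one m
  | succ s ih =>
    have h2 := h1 1 (by omega)
    simp only [one_ne_zero, if_false] at h2
    rw [pow_succ, ih, ← h2, genFun_mul_genFun, genFun_comp_equiv finSumFinEquiv]
    simp

theorem monomialQSym_one_pow_card (ι : Type*) [Fintype ι] :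
    monomialQSym [1] ^ Fintype.card ι = genFun fun _ : ι → ℕ+ => True := by
  rw [monomialQSym_one_pow, genFun_comp_equiv (Fintype.equivFin ι).symm]

theorem concatProd_monomialQSym_nil (F : QSeries) : F ⊚ monomialQSym [] = F := by
  classical
  funext m
  rw [concatProd_apply, Finset.sum_eq_single (m, 0)]
  · simp [monomialQSym, exponentList_eq_nil]
  · rintro ⟨a, b⟩ hp hne
    rw [Finset.mem_filter, Finset.HasAntidiagonal.mem_antidiagonal] at hp
    have : b ≠ 0 := by
      rintro rfl
      exact hne (by simpa using hp.1)
    simp [monomialQSym, exponentList_eq_nil, this]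
  · intro h
    exact absurd (Finset.mem_filter.2 ⟨Finset.HasAntidiagonal.mem_antidiagonal.2 (add_zero m),
      by simp⟩) h

/-- Splitting the ground set into D, T and the rest turns the cut conditions into free, constant and
free blocks, each lying strictly below the next ones. -/
theorem genFun_isCut {n : ℕ} {D T : Finset (Fin n)} (hd : Disjoint D T) :
    genFun (fun ω : Fin n → ℕ+ => IsCut ω D T) =
      monomialQSym [1] ^ D.card ⊚ monomialQSym (if T.card = 0 then [] else [T.card]) ⊚
        monomialQSym [1] ^ (n - D.card - T.card) := by
  classical
  have hC : n - D.card - T.card = Fintype.card ((D ∪ T)ᶜ : Finset (Fin n)) := by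
    rw [Fintype.card_coe, Finset.card_compl, Finset.card_union_of_disjoint hd, Fintype.card_fin,
      Nat.sub_sub]
  let f : (D ⊕ T) ⊕ ((D ∪ T)ᶜ : Finset (Fin n)) → Fin n :=
    Sum.elim (Sum.elim Subtype.val Subtype.val) Subtype.val
  have hf : Function.Bijective f := by
    constructor
    · have hdis := Finset.disjoint_left.1 hd
      rintro ((⟨a, ha⟩ | ⟨a, ha⟩) | ⟨a, ha⟩) ((⟨b, hb⟩ | ⟨b, hb⟩) | ⟨b, hb⟩) h <;>
        simp only [f, Sum.elim_inl, Sum.elim_inr] at h <;> subst h <;> grind [Finset.mem_compl]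
    · intro i
      by_cases h1 : i ∈ D
      · exact ⟨Sum.inl (Sum.inl ⟨i, h1⟩), rfl⟩
      · by_cases h2 : i ∈ T
        · exact ⟨Sum.inl (Sum.inr ⟨i, h2⟩), rfl⟩
        · exact ⟨Sum.inr ⟨i, by simp [h1, h2]⟩, rfl⟩
  rw [hC, ← Fintype.card_coe D, ← Fintype.card_coe T, monomialQSym_one_pow_card,
    monomialQSym_one_pow_card, ← genFun_const, concatProd_genFun, concatProd_genFun,
    genFun_comp_equiv (Equiv.ofBijective f hf)]
  congr 1
  funext ω
  have hTD : ∀ i ∈ T, i ∉ D := fun i hi => Finset.disjoint_right.1 hd hi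
  simp only [IsCut, f, Function.comp_apply, Equiv.ofBijective_apply, Sum.elim_inl, Sum.elim_inr,
    Sum.forall, Subtype.forall, Finset.mem_compl, Finset.mem_union, not_or, and_imp, true_and,
    eq_iff_iff]
  constructor
  · rintro ⟨h1, h2, h3⟩
    exact ⟨⟨h3, fun i hi j hj => h1 i hi j (hTD j hj)⟩, fun i hi j hj _ => h1 i hi j hj,
      fun i hi j hj hj' => h2 i hi j hj hj'⟩
  · rintro ⟨⟨h1, h2⟩, h3, h4⟩
    refine ⟨fun i hi j hj => ?_, fun i hi j hj hj' => h4 i hi j hj hj', h1⟩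
    by_cases hjT : j ∈ T
    · exact h2 i hi j hjT
    · exact h3 i hi j hj hjT

/-! ### Enumerators grouped by cuts -/

/-- The enumerator of the weights `ω`, with the coefficients `q ^ R ω`. -/
def rankEnumerator {n : ℕ} (R : (Fin n → ℕ+) → ℕ) : QSeries :=
  fun m => ∑ ω ∈ weightsOfContent (Fin n) m, X ^ R ω

/-- Existence and uniqueness of the cut say that the indicators of the cut conditions sum to 1 at
every weight. -/
theorem rankEnumerator_eq_sum_cutPairs {n s : ℕ} (h0 : 0 < s) (hs : s ≤ n)
    (R : (Fin n → ℕ+) → ℕ)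
    (hR : ∀ p ∈ cutPairs n s, ∀ ω, IsCut ω p.1 p.2 → R ω = p.2.card - 1) :
    rankEnumerator R = ∑ p ∈ cutPairs n s, (X ^ (p.2.card - 1) : ℤ[X]) •
      genFun fun ω : Fin n → ℕ+ => IsCut ω p.1 p.2 := by
  classical
  funext m
  have hev : ∀ (F : Finset (Fin n) × Finset (Fin n) → QSeries),
      (∑ p ∈ cutPairs n s, (X ^ (p.2.card - 1) : ℤ[X]) • F p) m =
        ∑ p ∈ cutPairs n s, (X ^ (p.2.card - 1) : ℤ[X]) * F p m := fun F =>
    Finset.sum_apply m (cutPairs n s) fun p => (X ^ (p.2.card - 1) : ℤ[X]) • F p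
  have hcard : ∀ p : Finset (Fin n) × Finset (Fin n),
      genFun (fun ω : Fin n → ℕ+ => IsCut ω p.1 p.2) m =
        ∑ ω ∈ weightsOfContent (Fin n) m, if IsCut ω p.1 p.2 then (1 : ℤ[X]) else 0 := by
    intro p
    rw [genFun_apply, Finset.sum_boole, Nat.subtype_card]
    intro ω
    rw [Finset.mem_filter, mem_weightsOfContent, and_comm]
  rw [hev]
  simp only [hcard, Finset.mul_sum, mul_ite, mul_one, mul_zero]
  rw [Finset.sum_comm, rankEnumerator]
  refine Finset.sum_congr rfl fun ω _ => ?_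
  obtain ⟨p, hp, hc⟩ := exists_isCut ω h0 hs
  rw [Finset.sum_eq_single p, if_pos hc, hR p hp ω hc]
  · intro q hq hqp
    exact if_neg fun h => hqp (isCut_unique hq hp h hc)
  · exact fun h => absurd hp h

/-- Reduces each enumerator to showing that the rank of a weight is |T| - 1 for its cut. -/
theorem rankEnumerator_eq {n s : ℕ} (h0 : 0 < s) (hs : s ≤ n) (R : (Fin n → ℕ+) → ℕ)
    (hR : ∀ p ∈ cutPairs n s, ∀ ω, IsCut ω p.1 p.2 → R ω = p.2.card - 1) :
    rankEnumerator R =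
      (n.choose s : ℤ[X]) • (monomialQSym [1] ^ s ⊚ monomialQSym [1] ^ (n - s)) +
      ∑ p ∈ (Finset.range (n + 1) ×ˢ Finset.range (n + 1)).filter
          (fun p => p.1 < s ∧ s < p.1 + p.2 ∧ p.1 + p.2 ≤ n),
        ((n.choose p.1 : ℤ[X]) * ((n - p.1).choose p.2 : ℤ[X]) * X ^ (p.2 - 1)) •
          (monomialQSym [1] ^ p.1 ⊚ monomialQSym [p.2] ⊚
            monomialQSym [1] ^ (n - p.1 - p.2)) := by
  have hsmul : ∀ (k : ℕ) (F : QSeries), k • F = (k : ℤ[X]) • F := fun k F =>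
    (Nat.cast_smul_eq_nsmul ℤ[X] k F).symm
  rw [rankEnumerator_eq_sum_cutPairs h0 hs R hR,
    Finset.sum_congr rfl fun p hp => by rw [genFun_isCut (mem_cutPairs.1 hp).1],
    sum_cutPairs n s fun a b => (X ^ (b - 1) : ℤ[X]) • (monomialQSym [1] ^ a ⊚
      monomialQSym (if b = 0 then [] else [b]) ⊚ monomialQSym [1] ^ (n - a - b))]
  congr 1
  · simp [hsmul, concatProd_monomialQSym_nil]
  · refine Finset.sum_congr rfl fun p hp => ?_
    rw [Finset.mem_filter] at hp
    rw [if_neg (by omega), hsmul, smul_smul, Nat.cast_mul]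

/-! ### Flags and weights -/

theorem scanl_add_eq_cons (a : ℕ) (e : List ℕ) :
    e.scanl (· + ·) a = a :: (e.scanl (· + ·) a).tail := by
  cases e <;> simp

/-- Differences undo partial sums; with `scanl_zipWith_sub` this passes between the type of a flag
and the cardinalities of its members. -/
theorem zipWith_sub_scanl (a : ℕ) (e : List ℕ) :
    List.zipWith (fun s t => t - s) (e.scanl (· + ·) a) (e.scanl (· + ·) a).tail = e := by
  induction e generalizing a with
  | nil => simp
  | cons x e ih =>
    have h := ih (a + x)
    rw [List.scanl_cons, List.tail_cons]
    rw [scanl_add_eq_cons (a + x) e] at h ⊢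
    rw [List.zipWith_cons_cons, Nat.add_sub_cancel_left]
    exact congrArg _ h

theorem scanl_zipWith_sub (a : ℕ) (l : List ℕ) (h : (a :: l).Pairwise (· ≤ ·)) :
    (List.zipWith (fun s t => t - s) (a :: l) l).scanl (· + ·) a = a :: l := by
  induction l generalizing a with
  | nil => simp
  | cons b l ih =>
    obtain ⟨h1, h2⟩ := List.pairwise_cons.1 h
    rw [List.zipWith_cons_cons, List.scanl_cons, Nat.add_sub_cancel' (h1 b (by simp)), ih b h2]

theorem pairwise_lt_scanl (a : ℕ) (e : List ℕ) (h : ∀ x ∈ e, 0 < x) :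
    (e.scanl (· + ·) a).Pairwise (· < ·) ∧ ∀ y ∈ e.scanl (· + ·) a, a ≤ y := by
  induction e generalizing a with
  | nil => simp
  | cons x e ih =>
    obtain ⟨h1, h2⟩ := ih (a + x) fun y hy => h y (by simp [hy])
    have hx := h x (by simp)
    rw [List.scanl_cons]
    refine ⟨List.pairwise_cons.2 ⟨fun y hy => ?_, h1⟩, fun y hy => ?_⟩
    · have := h2 y hy
      omega
    · rcases List.mem_cons.1 hy with rfl | hy
      · exact le_rfl
      · have := h2 y hy
        omega

/-- In a strictly increasing list, the prefix ending at `v` is the part with entries at most `v`. -/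
theorem mem_scanl_map (g : ℕ+ → ℕ) (L : List ℕ+) (hL : L.Pairwise (· < ·)) (a x : ℕ) :
    x ∈ (L.map g).scanl (· + ·) a ↔
      x = a ∨ ∃ v ∈ L, x = a + ((L.filter (· ≤ v)).map g).sum := by
  induction L generalizing a with
  | nil => simp
  | cons w L ih =>
    obtain ⟨h1, h2⟩ := List.pairwise_cons.1 hL
    have hw : L.filter (· ≤ w) = [] := List.filter_eq_nil_iff.2 fun u hu => by simpa using h1 u hu
    have hv : ∀ v ∈ L, (w :: L).filter (· ≤ v) = w :: L.filter (· ≤ v) := fun v hv =>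
      List.filter_cons_of_pos (by simpa using (h1 v hv).le)
    rw [List.map_cons, List.scanl_cons, List.mem_cons, ih h2]
    refine or_congr Iff.rfl ?_
    rw [List.exists_mem_cons_iff]
    refine or_congr ?_ (exists_congr fun v => and_congr_right fun h => ?_)
    · rw [List.filter_cons_of_pos (by simp), hw]
      simp
    · rw [hv v h, List.map_cons, List.sum_cons, add_assoc]

/-! ### Partial sums of exponents and the type of a flag -/

/-- The number of variables of index at most `v` in a monomial, counted with multiplicities. -/
def cumulative (m : ℕ+ →₀ ℕ) (v : ℕ+) : ℕ := ∑ u ∈ Finset.Iic v, m u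

theorem cumulative_mono (m : ℕ+ →₀ ℕ) : Monotone (cumulative m) := fun _ _ h =>
  Finset.sum_le_sum_of_subset (Finset.Iic_subset_Iic.2 h)

theorem cumulative_lt {m : ℕ+ →₀ ℕ} {u v : ℕ+} (h : u < v) (hv : v ∈ m.support) :
    cumulative m u < cumulative m v :=
  Finset.sum_lt_sum_of_subset (Finset.Iic_subset_Iic.2 h.le) (i := v) (by simp) (by simpa using h)
    (Nat.pos_of_ne_zero (Finsupp.mem_support_iff.1 hv)) fun _ _ _ => Nat.zero_le _

theorem cumulative_injective : Function.Injective cumulative := by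
  intro a b h
  ext v
  induction v using PNat.strongInductionOn with
  | _ v ih =>
    have h1 : cumulative a v = cumulative b v := congrFun h v
    simp only [cumulative, ← Finset.Iio_insert, Finset.sum_insert, Finset.mem_Iio, lt_irrefl,
      not_false_eq_true] at h1
    rw [Finset.sum_congr (g := b) rfl fun u hu => ih u (Finset.mem_Iio.1 hu)] at h1
    exact Nat.add_right_cancel h1

/-- The value at `v` is the one at the largest support element up to `v`, or 0 if there is none. -/
theorem cumulative_mem (m : ℕ+ →₀ ℕ) (v : ℕ+) :
    cumulative m v ∈ insert 0 (m.support.image (cumulative m)) := by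
  rcases (m.support.filter (· ≤ v)).eq_empty_or_nonempty with h | h
  · refine Finset.mem_insert.2 (Or.inl (Finset.sum_eq_zero fun u hu => ?_))
    by_contra hu'
    have : u ∈ m.support.filter (· ≤ v) :=
      Finset.mem_filter.2 ⟨Finsupp.mem_support_iff.2 hu', Finset.mem_Iic.1 hu⟩
    simp [h] at this
  · obtain ⟨u, hu, hmax⟩ := Finset.exists_max_image _ id h
    rw [Finset.mem_filter] at hu
    refine Finset.mem_insert_of_mem (Finset.mem_image.2 ⟨u, hu.1, ?_⟩)
    refine Finset.sum_subset (Finset.Iic_subset_Iic.2 hu.2) fun x hx hx' => ?_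
    by_contra hne
    exact hx' (Finset.mem_Iic.2 (hmax x (Finset.mem_filter.2
      ⟨Finsupp.mem_support_iff.2 hne, Finset.mem_Iic.1 hx⟩)))

theorem toFinset_scanl_exponentList (m : ℕ+ →₀ ℕ) :
    ((exponentList m).scanl (· + ·) 0).toFinset = insert 0 (m.support.image (cumulative m)) := by
  have hsum : ∀ v, ((((m.support.sort (· ≤ ·)).filter (· ≤ v)).map m)).sum = cumulative m v := by
    intro v
    rw [← List.sum_toFinset _ ((Finset.sort_nodup _ _).filter _)]
    have hs : ((m.support.sort (· ≤ ·)).filter (· ≤ v)).toFinset = m.support.filter (· ≤ v) := by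
      ext u
      simp
    rw [hs]
    refine Finset.sum_subset (fun u hu => Finset.mem_Iic.2 (Finset.mem_filter.1 hu).2)
      fun u hu hu' => ?_
    by_contra hne
    exact hu' (Finset.mem_filter.2 ⟨Finsupp.mem_support_iff.2 hne, Finset.mem_Iic.1 hu⟩)
  ext x
  rw [List.mem_toFinset, exponentList, mem_scanl_map _ _ (Finset.sortedLT_sort _).pairwise]
  simp only [hsum, zero_add, Finset.mem_sort, Finset.mem_insert, Finset.mem_image, eq_comm (a := x)]

theorem exponentList_pos {m : ℕ+ →₀ ℕ} : ∀ x ∈ exponentList m, 0 < x := by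
  intro x hx
  simp only [exponentList, List.mem_map, Finset.mem_sort, Finsupp.mem_support_iff] at hx
  obtain ⟨v, hv, rfl⟩ := hx
  exact Nat.pos_of_ne_zero hv

/-- Replaces an equality of lists by one of finite sets: both lists of partial sums are increasing
and start at 0. -/
theorem SetFlag.type_eq_exponentList_iff {n : ℕ} (F : SetFlag n) (m : ℕ+ →₀ ℕ) :
    F.type = exponentList m ↔
      F.sets.image Finset.card = insert 0 (m.support.image (cumulative m)) := by
  set C := F.sets.image Finset.card with hC
  have h0 : 0 ∈ C := Finset.mem_image.2 ⟨∅, F.empty_mem, rfl⟩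
  have hp : (C.sort (· ≤ ·)).Pairwise (· ≤ ·) := Finset.pairwise_sort _ _
  have htype : F.type = List.zipWith (fun s t => t - s) (C.sort (· ≤ ·)) (C.sort (· ≤ ·)).tail := rfl
  have hcons : ∃ l, C.sort (· ≤ ·) = 0 :: l := by
    have h0' : 0 ∈ C.sort (· ≤ ·) := (Finset.mem_sort _).2 h0
    rcases hl : C.sort (· ≤ ·) with _ | ⟨a, l⟩
    · simp [hl] at h0'
    · rw [hl] at h0' hp
      rcases List.mem_cons.1 h0' with h | h
      · exact ⟨l, by rw [h]⟩
      · have := (List.pairwise_cons.1 hp).1 0 h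
        exact ⟨l, by rw [Nat.le_zero.1 this]⟩
  obtain ⟨l, hl⟩ := hcons
  rw [← toFinset_scanl_exponentList]
  constructor
  · intro h
    rw [← h, htype, hl, List.tail_cons, scanl_zipWith_sub 0 l (hl ▸ hp), ← hl]
    exact (Finset.sort_toFinset _ _).symm
  · intro h
    have h1 := (pairwise_lt_scanl 0 (exponentList m) exponentList_pos).1
    have h2 : C.sort (· ≤ ·) = (exponentList m).scanl (· + ·) 0 := by
      rw [h]
      exact (List.toFinset_sort (· ≤ ·) (h1.imp fun h => h.ne)).2 (h1.imp fun h => h.le)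
    rw [htype, h2, zipWith_sub_scanl]

/-! ### The correspondence between weights and flags -/

theorem card_level {n : ℕ} (ω : Fin n → ℕ+) (v : ℕ+) :
    (Finset.univ.filter fun i => ω i ≤ v).card = cumulative (weightContent ω) v := by
  rw [cumulative, Finset.card_eq_sum_card_fiberwise (f := ω) (t := Finset.Iic v)]
  · refine Finset.sum_congr rfl fun u hu => ?_
    rw [weightContent_apply, Finset.filter_filter]
    congr 1
    refine Finset.filter_congr fun i _ => ?_
    rw [Finset.mem_Iic] at hu
    exact ⟨fun h => h.2, fun h => ⟨h ▸ hu, h⟩⟩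
  · intro i hi
    simpa using hi

theorem SetFlag.mem_sets_ofWeight {n : ℕ} (hn : 0 < n) (ω : Fin n → ℕ+) (A : Finset (Fin n)) :
    A ∈ (SetFlag.ofWeight ω).sets ↔ A = ∅ ∨ ∃ j, A = Finset.univ.filter fun i => ω i ≤ ω j := by
  classical
  simp only [SetFlag.ofWeight, Finset.mem_insert, Finset.mem_image, Finset.mem_univ, true_and]
  refine or_congr Iff.rfl ⟨?_, ?_⟩
  · rintro (rfl | ⟨j, rfl⟩)
    · obtain ⟨j, -, hj⟩ := Finset.exists_max_image Finset.univ ω ⟨⟨0, hn⟩, Finset.mem_univ _⟩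
      exact ⟨j, (Finset.filter_true_of_mem hj).symm⟩
    · exact ⟨j, rfl⟩
  · rintro ⟨j, rfl⟩
    exact Or.inr ⟨j, rfl⟩

theorem SetFlag.ofWeight_lt_iff {n : ℕ} (ω : Fin n → ℕ+) (p q : Fin n) :
    (∃ A ∈ (SetFlag.ofWeight ω).sets, p ∈ A ∧ q ∉ A) ↔ ω p < ω q := by
  rw [← SetFlag.mem_braidInterior_ofWeight ω p q, Nat.cast_lt, PNat.coe_lt_coe]

theorem SetFlag.type_ofWeight {n : ℕ} (hn : 0 < n) (ω : Fin n → ℕ+) :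
    (SetFlag.ofWeight ω).type = exponentList (weightContent ω) := by
  rw [SetFlag.type_eq_exponentList_iff]
  ext x
  simp only [Finset.mem_image, Finset.mem_insert, SetFlag.mem_sets_ofWeight hn,
    mem_support_weightContent]
  constructor
  · rintro ⟨A, rfl | ⟨j, rfl⟩, rfl⟩
    · exact Or.inl rfl
    · exact Or.inr ⟨ω j, ⟨j, rfl⟩, (card_level ω _).symm⟩
  · rintro (rfl | ⟨_, ⟨j, rfl⟩, rfl⟩)
    · exact ⟨∅, Or.inl rfl, rfl⟩
    · exact ⟨_, Or.inr ⟨j, rfl⟩, card_level ω _⟩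

/-- The flag fixes only the relative order of the values. Equal level sets then give equal values of
`cumulative`, which is strictly increasing on the support, so the common content fixes the values
themselves. -/
theorem SetFlag.ofWeight_injOn {n : ℕ} {ω ω' : Fin n → ℕ+}
    (hc : weightContent ω = weightContent ω')
    (h : SetFlag.ofWeight ω = SetFlag.ofWeight ω') : ω = ω' := by
  have hlt : ∀ p q, ω p < ω q ↔ ω' p < ω' q := fun p q => by
    rw [← SetFlag.ofWeight_lt_iff, ← SetFlag.ofWeight_lt_iff, h]
  funext i
  have hcum : cumulative (weightContent ω) (ω i) = cumulative (weightContent ω) (ω' i) := by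
    conv_rhs => rw [hc]
    rw [← card_level, ← card_level]
    congr 1
    refine Finset.filter_congr fun j _ => ?_
    rw [← not_lt, ← not_lt, hlt]
  have hmem : ω i ∈ (weightContent ω).support := (mem_support_weightContent _ _).2 ⟨i, rfl⟩
  have hmem' : ω' i ∈ (weightContent ω).support := hc ▸ (mem_support_weightContent _ _).2 ⟨i, rfl⟩
  rcases lt_trichotomy (ω i) (ω' i) with h1 | h1 | h1
  · exact absurd hcum (cumulative_lt h1 hmem').ne
  · exact h1
  · exact absurd hcum (cumulative_lt h1 hmem).ne'

theorem SetFlag.eq_of_card_eq {n : ℕ} (F : SetFlag n) {A B : Finset (Fin n)} (hA : A ∈ F.sets)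
    (hB : B ∈ F.sets) (h : A.card = B.card) : A = B := by
  rcases F.chain A hA B hB with h' | h'
  · exact Finset.eq_of_subset_of_card_le h' h.ge
  · exact (Finset.eq_of_subset_of_card_le h' h.le).symm

/-- `S v` is the member of the flag with as many elements as there should be weights at most `v`;
the weight of `i` is the least `v` with `i ∈ S v`. -/
theorem SetFlag.exists_ofWeight_eq {n : ℕ} (hn : 0 < n) (F : SetFlag n) (m : ℕ+ →₀ ℕ)
    (h : F.type = exponentList m) :
    ∃ ω : Fin n → ℕ+, weightContent ω = m ∧ SetFlag.ofWeight ω = F := by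
  have hC := (F.type_eq_exponentList_iff m).1 h
  have hS : ∀ v, ∃ A ∈ F.sets, A.card = cumulative m v := fun v => by
    have := cumulative_mem m v
    rw [← hC] at this
    simpa using this
  choose S hSF hScard using hS
  have hSmono : ∀ u v, u ≤ v → S u ⊆ S v := fun u v huv => by
    rcases F.chain _ (hSF u) _ (hSF v) with h' | h'
    · exact h'
    · refine (Finset.eq_of_subset_of_card_le h' ?_).ge
      rw [hScard, hScard]
      exact cumulative_mono m huv
  obtain ⟨v₀, hv₀⟩ : ∃ v, S v = Finset.univ := by
    have hu : (Finset.univ : Finset (Fin n)).card ∈ F.sets.image Finset.card :=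
      Finset.mem_image_of_mem _ F.univ_mem
    rw [hC, Finset.mem_insert, Finset.mem_image] at hu
    rcases hu with hu | ⟨v, -, hv⟩
    · simp at hu
      omega
    · exact ⟨v, F.eq_of_card_eq (hSF v) F.univ_mem ((hScard v).trans hv)⟩
  have hω : ∀ i, ∃ v, ∀ u, v ≤ u ↔ i ∈ S u := fun i => by
    obtain ⟨v, hv, hmin⟩ := wellFounded_lt.has_min {v : ℕ+ | i ∈ S v} ⟨v₀, by simp [hv₀]⟩
    exact ⟨v, fun u => ⟨fun h => hSmono v u h hv, fun h => not_lt.1 (hmin u h)⟩⟩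
  choose ω hω using hω
  have hlevel : ∀ v, (Finset.univ.filter fun i => ω i ≤ v) = S v := fun v => by
    ext i
    simp [hω]
  have hcontent : weightContent ω = m := by
    refine cumulative_injective (funext fun v => ?_)
    rw [← card_level, hlevel, hScard]
  refine ⟨ω, hcontent, SetFlag.ext ?_⟩
  have hsub : (SetFlag.ofWeight ω).sets ⊆ F.sets := by
    intro A hA
    rcases (SetFlag.mem_sets_ofWeight hn ω A).1 hA with rfl | ⟨j, rfl⟩
    · exact F.empty_mem
    · rw [hlevel]
      exact hSF _
  refine Finset.Subset.antisymm hsub fun A hA => ?_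
  -- The two flags have the same set of cardinalities, and a member of a chain is determined by its
  -- size, so `F` has no further members.
  have hcard : A.card ∈ F.sets.image Finset.card := Finset.mem_image_of_mem _ hA
  have h2 := SetFlag.type_ofWeight hn ω
  rw [hcontent] at h2
  rw [hC, ← (SetFlag.type_eq_exponentList_iff _ m).1 h2] at hcard
  obtain ⟨B, hB, hBA⟩ := Finset.mem_image.1 hcard
  rw [← F.eq_of_card_eq (hsub hB) hA hBA]
  exact hB

theorem sum_flags_eq_rankEnumerator {n : ℕ} (hn : 0 < n) (R : SetFlag n → ℕ) :
    ∑ F : SetFlag n, (X ^ R F : ℤ[X]) • monomialQSym F.type =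
      rankEnumerator fun ω => R (SetFlag.ofWeight ω) := by
  classical
  funext m
  have hev : (∑ F : SetFlag n, (X ^ R F : ℤ[X]) • monomialQSym F.type : QSeries) m =
      ∑ F : SetFlag n, (X ^ R F : ℤ[X]) * if exponentList m = F.type then 1 else 0 := by
    refine (Finset.sum_apply m Finset.univ fun F : SetFlag n =>
      (X ^ R F : ℤ[X]) • monomialQSym F.type).trans (Finset.sum_congr rfl fun F _ => ?_)
    change X ^ R F * monomialQSym F.type m = _
    unfold monomialQSym
    congr
  rw [hev, rankEnumerator]
  simp only [mul_ite, mul_one, mul_zero]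
  rw [← Finset.sum_filter]
  symm
  refine Finset.sum_bij (fun ω _ => SetFlag.ofWeight ω) ?_ ?_ ?_ ?_
  · intro ω hω
    rw [mem_weightsOfContent] at hω
    rw [Finset.mem_filter, SetFlag.type_ofWeight hn, hω]
    exact ⟨Finset.mem_univ _, rfl⟩
  · intro ω hω ω' hω' h
    rw [mem_weightsOfContent] at hω hω'
    exact SetFlag.ofWeight_injOn (hω.trans hω'.symm) h
  · intro F hF
    obtain ⟨ω, hω, hF⟩ := F.exists_ofWeight_eq hn m (Finset.mem_filter.1 hF).2.symm
    exact ⟨ω, mem_weightsOfContent.2 hω, hF⟩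
  · intros; rfl

/-! ### Ranks of flags -/

/-- Cuts depend only on the order of the values, so they transfer from `ω` to every vector in the
braid cone of its flag. -/
theorem IsCut.of_lt_iff {ι L L' : Type*} [LinearOrder L] [LinearOrder L'] {ω : ι → L}
    {v : ι → L'} {D T : Finset ι} (hc : IsCut ω D T) (h : ∀ i j, v i < v j ↔ ω i < ω j) :
    IsCut v D T := by
  refine ⟨fun i hi j hj => (h i j).2 (hc.1 i hi j hj),
    fun i hi j hj hj' => (h i j).2 (hc.2.1 i hi j hj hj'), fun i hi j hj => ?_⟩
  have heq := hc.2.2 i hi j hj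
  refine le_antisymm (not_lt.1 fun hlt => ?_) (not_lt.1 fun hlt => ?_)
  · exact ((h j i).1 hlt).ne' heq
  · exact ((h i j).1 hlt).ne heq

/-- Passes from cuts read from the bottom at `n - r` to cuts read from the top at `r`. -/
theorem compl_union_mem_cutPairs {n r : ℕ} (hn : r < n)
    {p : Finset (Fin n) × Finset (Fin n)} (hp : p ∈ cutPairs n (n - r)) :
    ((p.1 ∪ p.2)ᶜ, p.2) ∈ cutPairs n r := by
  obtain ⟨hd, hc⟩ := mem_cutPairs.1 hp
  have hu := Finset.card_union_of_disjoint hd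
  have h1 := Finset.card_compl (p.1 ∪ p.2)
  have h2 := Finset.card_le_univ (p.1 ∪ p.2)
  rw [Fintype.card_fin] at h1 h2
  refine mem_cutPairs.2 ⟨?_, ?_⟩
  · rw [Finset.disjoint_left]
    intro i hi hi'
    simp only [Finset.mem_compl, Finset.mem_union, not_or] at hi
    exact hi.2 hi'
  · rcases hc with ⟨h3, h4⟩ | h3
    · refine Or.inl ⟨?_, h4⟩
      have : p.2.card = 0 := by simp [h4]
      simp only
      omega
    · right
      simp only
      omega

theorem flagRank_hypersimplex {n r : ℕ} (hn : r < n)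
    {p : Finset (Fin n) × Finset (Fin n)} (hp : p ∈ cutPairs n (n - r)) {ω : Fin n → ℕ+}
    (hc : IsCut ω p.1 p.2) :
    flagRank (hypersimplex n r) (SetFlag.ofWeight ω) = p.2.card - 1 := by
  obtain ⟨A, hA⟩ : ∃ A, A = (p.1 ∪ p.2)ᶜ := ⟨_, rfl⟩
  have hp' : (A, p.2) ∈ cutPairs n r := hA ▸ compl_union_mem_cutPairs hn hp
  have hAmem : ∀ i, i ∈ A ↔ i ∉ p.1 ∧ i ∉ p.2 := fun i => by simp [hA]
  have key : ∀ w ∈ (SetFlag.ofWeight ω).braidInterior,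
      maxFace (hypersimplex n r) w = cutFace r A p.2 := by
    intro w hw
    have hcw : IsCut w p.1 p.2 := hc.of_lt_iff fun i j =>
      (hw i j).trans (SetFlag.ofWeight_lt_iff ω i j)
    obtain ⟨t, h1, h2, h3⟩ := exists_threshold (mem_cutPairs.1 hp).1 hcw
    have h4 : ∀ i ∈ A, t < w i := fun i hi => h3 i ((hAmem i).1 hi).1 ((hAmem i).1 hi).2
    have h5 : ∀ i ∉ A, i ∉ p.2 → w i < t := fun i hi hi' =>
      h1 i (by_contra fun h => hi ((hAmem i).2 ⟨h, hi'⟩))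
    have hmax : ∀ x ∈ hypersimplex n r, (∀ y ∈ hypersimplex n r, w ⬝ᵥ y ≤ w ⬝ᵥ x) ↔
        x ∈ cutFace r A p.2 := fun x hx =>
      isMax_iff_mem_cutFace h4 h2 h5 subset_rfl (cutFace_inter_nonempty hp') hx
    ext x
    exact ⟨fun hx => (hmax x hx.1).1 hx.2, fun hx => ⟨hx.1, (hmax x hx.1).2 hx⟩⟩
  have hface : flagFace (hypersimplex n r) (SetFlag.ofWeight ω) = cutFace r A p.2 := by
    ext x
    constructor
    · intro hx
      rw [← key _ (SetFlag.mem_braidInterior_ofWeight ω)]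
      exact hx _ (SetFlag.mem_braidInterior_ofWeight ω)
    · intro hx w hw
      rwa [key w hw]
  have hdim := polytopeDim_cutFace hp'
  simp only at hdim
  rw [flagRank, hface, hdim]

/-- Ensures that the quantifier over decreasing weights in `flagBases` is not vacuous. -/
theorem SetFlag.exists_isDecreasingWeight {n : ℕ} (ω : Fin n → ℕ+) :
    ∃ ω', (SetFlag.ofWeight ω).IsDecreasingWeight ω' := by
  obtain ⟨N, hN⟩ := (Set.finite_range ω).bddAbove
  have hN' : ∀ i, ω i ≤ N := fun i => hN ⟨i, rfl⟩
  refine ⟨fun i => ⟨(N : ℕ) + 1 - ω i, ?_⟩, fun p q => ?_⟩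
  · have : (ω i : ℕ) ≤ N := hN' i
    omega
  · rw [SetFlag.ofWeight_lt_iff]
    change (N : ℕ) + 1 - ω q < (N : ℕ) + 1 - ω p ↔ (ω p : ℕ) < ω q
    have h1 : (ω p : ℕ) ≤ N := hN' p
    have h2 : (ω q : ℕ) ≤ N := hN' q
    omega

/-- The negative of a decreasing weight has the same cut as `ω`, and the weight of a basis is the
pairing with e_B, so the maximization applies to the set of all e_B. -/
theorem maxWeightBases_uniformMatroid {n r : ℕ} (hn : r < n)
    {p : Finset (Fin n) × Finset (Fin n)} (hp : p ∈ cutPairs n r) {ω ω' : Fin n → ℕ+}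
    (hc : IsCut ω p.1 p.2) (hω' : (SetFlag.ofWeight ω).IsDecreasingWeight ω') :
    maxWeightBases (uniformMatroid n r hn.le) ω' = cutBases r p.1 p.2 := by
  have hcw : IsCut (fun i => -((ω' i : ℕ) : ℝ)) p.1 p.2 := hc.of_lt_iff fun i j => by
    rw [← SetFlag.ofWeight_lt_iff ω i j, ← hω' i j, neg_lt_neg_iff, Nat.cast_lt, PNat.coe_lt_coe]
  obtain ⟨t, h1, h2, h3⟩ := exists_threshold (mem_cutPairs.1 hp).1 hcw
  have hdot : ∀ B : Set (Fin n), ((∑ i, B.indicator (fun i => (ω' i : ℕ)) i : ℕ) : ℝ) =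
      (fun i => ((ω' i : ℕ) : ℝ)) ⬝ᵥ B.indicator 1 := by
    classical
    intro B
    rw [Nat.cast_sum, dotProduct]
    refine Finset.sum_congr rfl fun i _ => ?_
    by_cases hi : i ∈ B <;> simp [hi]
  obtain ⟨B₀, hB₀⟩ := cutBases_nonempty hp
  have hmax := fun x hx => isMax_iff_mem_cutFace (r := r) (A := p.1) (T := p.2)
    (w := fun i => ((ω' i : ℕ) : ℝ)) (t := -t) (fun i hi => by linarith [h1 i hi])
    (fun i hi => by linarith [h2 i hi]) (fun i hi hi' => by linarith [h3 i hi hi'])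
    (S := (fun B : Set (Fin n) => B.indicator (1 : Fin n → ℝ)) '' {B | B.ncard = r})
    (by
      rintro _ ⟨B, hB, rfl⟩
      exact indicator_mem_hypersimplex hB)
    ⟨B₀.indicator 1, ⟨B₀, hB₀.1, rfl⟩, (indicator_mem_cutFace hB₀.1).2 hB₀⟩ (x := x) hx
  ext B
  constructor
  · rintro ⟨hB, hB'⟩
    rw [uniformMatroid_isBase] at hB
    refine (indicator_mem_cutFace hB).1 ((hmax _ ⟨B, hB, rfl⟩).1 ?_)
    rintro _ ⟨B', hB1, rfl⟩
    simp only
    rw [← hdot, ← hdot, Nat.cast_le]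
    exact hB' B' hB1
  · intro hB
    refine ⟨hB.1, fun B' hB' => ?_⟩
    have := (hmax _ ⟨B, hB.1, rfl⟩).2 ((indicator_mem_cutFace hB.1).2 hB) _ ⟨B', hB', rfl⟩
    simp only at this
    rwa [← hdot, ← hdot, Nat.cast_le] at this

theorem matroidFlagRank_uniformMatroid {n r : ℕ} (hn : r < n)
    {p : Finset (Fin n) × Finset (Fin n)} (hp : p ∈ cutPairs n r) {ω : Fin n → ℕ+}
    (hc : IsCut ω p.1 p.2) :
    matroidFlagRank (uniformMatroid n r hn.le) (SetFlag.ofWeight ω) = p.2.card - 1 := by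
  have h : flagBases (uniformMatroid n r hn.le) (SetFlag.ofWeight ω) = cutBases r p.1 p.2 := by
    ext B
    constructor
    · intro hB
      obtain ⟨ω', hω'⟩ := SetFlag.exists_isDecreasingWeight ω
      rw [← maxWeightBases_uniformMatroid hn hp hc hω']
      exact hB ω' hω'
    · intro hB ω' hω'
      rwa [maxWeightBases_uniformMatroid hn hp hc hω']
  rw [matroidFlagRank, h, polytopeDim_basePolytope_cutBases hp]

/-! ### The two enumerators -/

theorem weightEnumerator_eq_rankEnumerator {n : ℕ} (Q : Set (Fin n → ℝ)) :
    weightEnumerator Q = rankEnumerator fun ω => flagRank Q (SetFlag.ofWeight ω) := by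
  funext m
  unfold weightEnumerator rankEnumerator weightsOfContent weightContent
  congr

theorem weightEnumerator_hypersimplex {n r : ℕ} (h0 : 0 < r) (hn : r < n) :
    weightEnumerator (hypersimplex n r) =
      (n.choose r : ℤ[X]) • (monomialQSym [1] ^ (n - r) ⊚ monomialQSym [1] ^ r) +
      ∑ p ∈ (Finset.range (n + 1) ×ˢ Finset.range (n + 1)).filter
          (fun p => p.1 < r ∧ r < p.1 + p.2 ∧ p.1 + p.2 ≤ n),
        ((n.choose p.1 : ℤ[X]) * ((n - p.1).choose p.2 : ℤ[X]) * X ^ (p.2 - 1)) •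
          (monomialQSym [1] ^ (n - p.1 - p.2) ⊚ monomialQSym [p.2] ⊚
            monomialQSym [1] ^ p.1) := by
  rw [weightEnumerator_eq_rankEnumerator, rankEnumerator_eq (s := n - r) (by omega) (by omega) _
    fun p hp ω hc => flagRank_hypersimplex hn hp hc, Nat.choose_symm hn.le, Nat.sub_sub_self hn.le]
  congr 1
  -- The involution exchanging the numbers of elements below and above the tie level converts the
  -- index set for `n - r` into the one for `r`.
  refine Finset.sum_bij' (fun p _ => (n - p.1 - p.2, p.2)) (fun p _ => (n - p.1 - p.2, p.2))
    ?_ ?_ ?_ ?_ ?_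
  · rintro ⟨a, b⟩ hp
    simp only [Finset.mem_filter, Finset.mem_product, Finset.mem_range] at hp ⊢
    omega
  · rintro ⟨a, b⟩ hp
    simp only [Finset.mem_filter, Finset.mem_product, Finset.mem_range] at hp ⊢
    omega
  · rintro ⟨a, b⟩ hp
    simp only [Finset.mem_filter] at hp
    simp only [Prod.mk.injEq, and_true]
    omega
  · rintro ⟨a, b⟩ hp
    simp only [Finset.mem_filter] at hp
    simp only [Prod.mk.injEq, and_true]
    omega
  · rintro ⟨a, b⟩ hp
    simp only [Finset.mem_filter] at hp
    have h1 : n - (n - a - b) - b = a := by omega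
    -- Both sides count ordered splittings into blocks of sizes `a`, `b` and `n - a - b`.
    have h2 : n.choose a * (n - a).choose b =
        n.choose (n - a - b) * (n - (n - a - b)).choose b := by
      rw [← Nat.choose_symm (show n - a - b ≤ n by omega),
        show n - (n - a - b) = a + b by omega, ← Nat.choose_symm (show b ≤ a + b by omega),
        Nat.add_sub_cancel, Nat.choose_mul (Nat.le_add_right a b),
        Nat.add_sub_cancel_left]
    simp only [h1]
    rw [← Nat.cast_mul, ← Nat.cast_mul, h2]

theorem matroidEnumerator_uniformMatroid {n r : ℕ} (h0 : 0 < r) (hn : r < n) :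
    matroidEnumerator (uniformMatroid n r hn.le) =
      (n.choose r : ℤ[X]) • (monomialQSym [1] ^ r ⊚ monomialQSym [1] ^ (n - r)) +
      ∑ p ∈ (Finset.range (n + 1) ×ˢ Finset.range (n + 1)).filter
          (fun p => p.1 < r ∧ r < p.1 + p.2 ∧ p.1 + p.2 ≤ n),
        ((n.choose p.1 : ℤ[X]) * ((n - p.1).choose p.2 : ℤ[X]) * X ^ (p.2 - 1)) •
          (monomialQSym [1] ^ p.1 ⊚ monomialQSym [p.2] ⊚
            monomialQSym [1] ^ (n - p.1 - p.2)) := by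
  rw [matroidEnumerator, sum_flags_eq_rankEnumerator (by omega)]
  exact rankEnumerator_eq h0 hn.le _ fun p hp ω hc => matroidFlagRank_uniformMatroid hn hp hc

end

theorem mainTheorem9 (n r : ℕ) (h0 : 0 < r) (hn : r < n) :
    -- the polytope of the uniform matroid is the hypersimplex
    matroidPolytope (uniformMatroid n r hn.le) = hypersimplex n r ∧
    -- the expansion of the enumerator, as a sum over flags with decreasing weights
    matroidEnumerator (uniformMatroid n r hn.le) =
      (n.choose r : ℤ[X]) • (monomialQSym [1] ^ r ⊚ monomialQSym [1] ^ (n - r)) +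
      ∑ p ∈ (Finset.range (n + 1) ×ˢ Finset.range (n + 1)).filter
          (fun p => p.1 < r ∧ r < p.1 + p.2 ∧ p.1 + p.2 ≤ n),
        ((n.choose p.1 : ℤ[X]) * ((n - p.1).choose p.2 : ℤ[X]) * X ^ (p.2 - 1)) •
          (monomialQSym [1] ^ p.1 ⊚ monomialQSym [p.2] ⊚ monomialQSym [1] ^ (n - p.1 - p.2)) ∧
    -- the expansion of the enumerator, as a sum over positive integer vectors
    weightEnumerator (matroidPolytope (uniformMatroid n r hn.le)) =
      (n.choose r : ℤ[X]) • (monomialQSym [1] ^ (n - r) ⊚ monomialQSym [1] ^ r) +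
      ∑ p ∈ (Finset.range (n + 1) ×ˢ Finset.range (n + 1)).filter
          (fun p => p.1 < r ∧ r < p.1 + p.2 ∧ p.1 + p.2 ≤ n),
        ((n.choose p.1 : ℤ[X]) * ((n - p.1).choose p.2 : ℤ[X]) * X ^ (p.2 - 1)) •
          (monomialQSym [1] ^ (n - p.1 - p.2) ⊚ monomialQSym [p.2] ⊚ monomialQSym [1] ^ p.1) ∧
    -- the `f`-polynomial
    fPolynomial (matroidPolytope (uniformMatroid n r hn.le)) =
      (n.choose r : ℤ[X]) +
      ∑ p ∈ (Finset.range (n + 1) ×ˢ Finset.range (n + 1)).filter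
          (fun p => p.1 < r ∧ r < p.1 + p.2 ∧ p.1 + p.2 ≤ n),
        (n.choose p.1 : ℤ[X]) * ((n - p.1).choose p.2 : ℤ[X]) * X ^ (p.2 - 1) ∧
    -- the `f`-vector
    faceNumber (matroidPolytope (uniformMatroid n r hn.le)) 0 = n.choose r ∧
    ∀ k, 2 ≤ k → k ≤ n →
      faceNumber (matroidPolytope (uniformMatroid n r hn.le)) (k - 1) =
        ∑ s ∈ (Finset.range (n + 1)).filter (fun s => s < r ∧ r < s + k ∧ s + k ≤ n),
          Nat.multinomial Finset.univ ![s, k, n - s - k] := by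
  rw [matroidPolytope_uniformMatroid h0 hn]
  exact ⟨rfl, matroidEnumerator_uniformMatroid h0 hn, weightEnumerator_hypersimplex h0 hn,
    fPolynomial_hypersimplex h0 hn, faceNumber_hypersimplex_zero h0 hn,
    fun k hk hkn => faceNumber_hypersimplex_sub_one h0 hn hk hkn⟩
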